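/- **Conventions.** Points of two-dimensional Minkowski space are $x=(x^0,x^1)$, and $W=\{x:|x^0|<x^1\}$ is the right wedge. For $m>0$ put $p_0=m\cosh\zeta$, $p_1=m\sinh\zeta$ (covariant components) and $px=p_0x^0+p_1x^1$. For a complex-valued Schwartz function $\hat f$ on $\mathbb R^2$ let $$f(\zeta)=\frac1{\sqrt{2\pi}}\int e^{-ip(\zeta)x}\hat f(x)\,d^2x ,$$ which is defined for $\zeta=\theta$ and $\zeta=\theta-i\pi$ with $\theta$ real; if $\hat f$ is real, then $f(\theta-i\pi)=\overline{f(\theta)}$. "$\operatorname{supp}\hat f\subset W$" means that $\hat f$ vanishes outside $W$. All operators are considered on the dense domain $D$ of vectors of finite particle number in the Fock space $\mathcal H$, and $\Omega$ is the vacuum. **(A) One self-conjugate particle.** Let $m>0$ and let $\vartheta:\mathbb R\to\mathbb R$ be a scattering phase, i.e. $e^{i\vartheta(\theta)}=S(\theta)$ for real $\theta$, where $S$ is continuous and bounded on the strip $0\le\operatorname{Im}\zeta\le\pi$, holomorphic in its interior, and satisfies $S(\theta)S(-\theta)=1$ and the crossing relation $S(\theta+i\pi)=S(-\theta)$ for real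 $\theta$. On the bosonic Fock space over $L^2(\mathbb R,d\theta)$, with annihilation operators $a(\theta)$, let $$Z(\theta)=a(\theta)\exp\Big(-i\int_{-\infty}^{\theta}\vartheta(\theta-\theta')\,a^*(\theta')a(\theta')\,d\theta'\Big),\qquad Z(x)=\frac1{\sqrt{2\pi}}\int\big(e^{-ipx}Z(\theta)+e^{ipx}Z^*(\theta)\big)d\theta ,$$ $$Z(\hat f)=\int Z(x)\hat f(x)\,d^2x=\int\big(f(\theta)Z(\theta)+f(\theta-i\pi)Z^*(\theta)\big)d\theta ,$$ and let $J=S_sJ_0$, where $J_0$ is complex conjugation of the rapidity wave functions and $S_s$ multiplies an $n$-particle wave function by $\prod_{\{i,j\}:\,\theta_i>\theta_j}S(\theta_i-\theta_j)$. Then $J$ and all $Z(\hat f)$ map $D$ into $D$, the Hermitian conjugate of $Z(\hat f)$ on $D$ is $Z(\overline{\hat f})$, and $Z$ is wedge-local: for $\operatorname{supp}\hat f,\operatorname{supp}\hat g\subset W$, $$[JZ(\hat f)J,\,Z(\hat g)]=0\ \text{ on } D,\qquad Z(\hat f)\Omega=\int f(\theta-i\pi)\,a^*(\theta)\,\Omega\,d\theta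 ,$$ the latter being a one-particle state, equal to $\int\overline{f(\theta)}\,a^*(\theta)\Omega\,d\theta$ if $\hat f$ is real. **(B) Federbush model.** Let $g\in\mathbb R$ and $m_I,m_{II}>0$. On the fermionic Fock space of two species $I,II$ of particles and antiparticles, with annihilation operators $a_I,a_{II}$ (particles) and $b_I,b_{II}$ (antiparticles) and charge densities $\rho_s=a_s^*a_s-b_s^*b_s$ in rapidity space, let $$c_I(\theta)=a_I(\theta)e^{-i\pi g\int_{-\infty}^\theta\rho_{II}},\quad d_I(\theta)=b_I(\theta)e^{i\pi g\int_{-\infty}^\theta\rho_{II}},\quad c_{II}(\theta)=a_{II}(\theta)e^{i\pi g\int_{-\infty}^\theta\rho_{I}},\quad d_{II}(\theta)=b_{II}(\theta)e^{-i\pi g\int_{-\infty}^\theta\rho_{I}},$$ $$Z_s(x)=\frac1{\sqrt{2\pi}}\int\big(e^{-ipx}c_s(\theta)+e^{ipx}d_s^*(\theta)\big)d\theta\qquad(s=I,II,\ \text{with mass } m_s),$$ so that $c_I(\theta_1)c_{II}(\theta_2)=-e^{i\pi g}c_{II}(\theta_2)c_I(\theta_1)$. Let $J=S_sJ_0$ with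 $$S_s=\exp\Big(i\pi g\iint\rho_I(\theta_1)\rho_{II}(\theta_2)\,\varepsilon(\theta_1-\theta_2)\,d\theta_1d\theta_2\Big),$$ $\varepsilon$ the sign function, and $J_0$ the antiunitary operator that conjugates the wave functions, exchanges particles and antiparticles, and reverses the order of the arguments (the factor $(-1)^{n(n-1)/2}$ of the Klein transformation). Then $J$ and all $Z_s(\hat f)$, $Z_s^*(\hat f)=\int Z_s(x)^*\hat f(x)\,d^2x$ map $D$ into $D$, $Z_s(\hat f)$ and $Z_s^*(\overline{\hat f})$ are Hermitian conjugate on $D$, and: 1. operators of different species commute directly in rapidity space: for $s\ne s'$ and $Z_s^\#\in\{c_s,d_s,c_s^*,d_s^*\}$, $$[JZ_s^\#(\theta)J,\,Z_{s'}^\#(\theta')]=0 ,$$ in the sense that the commutator vanishes on $D$ after smearing with arbitrary square-integrable functions of $\theta$ and $\theta'$; 2. for all $s,s'\in\{I,II\}$ and $\operatorname{supp}\hat f,\operatorname{supp}\hat h\subset W$, the operators $JZ_s(\hat f)J$ and $JZ_s^*(\hat f)J$ commute with $Z_{s'}(\hat h)$ and $Z_{s'}^*(\hat h)$ on $D$.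 -/

import Mathlib

open MeasureTheory
open scoped ComplexConjugate SchwartzMap

noncomputable section

namespace FWG

/-! ### Fock space: finite-particle vectors as sequences of square-integrable wave functions -/

/-- A sequence of `n`-particle wave functions; `X` is the space of one-particle labels. -/
abbrev Wave (X : Type) : Type := (n : ℕ) → (Fin n → X) → ℂ

inductive Statistics where
  | bose : Statistics
  | fermi : Statistics

/-- The character of the permutation group belonging to the statistics. -/
def Statistics.character : Statistics → (n : ℕ) → Equiv.Perm (Fin n) → ℂ
  | .bose, _, _ => 1
  | .fermi, _, p => ((Equiv.Perm.sign p : ℤ) : ℂ)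

/-- The sign picked up when a particle is moved past `k` others. -/
def Statistics.swapSign : Statistics → ℕ → ℂ
  | .bose, _ => 1
  | .fermi, k => (-1) ^ k

section Fock

variable {X : Type} [MeasurableSpace X]

/-- The `n`-fold product of the one-particle measure. -/
def nMeasure (μ : Measure X) (n : ℕ) : Measure (Fin n → X) := Measure.pi fun _ => μ

/-- Equality of Fock space vectors, i.e. of classes of wave functions modulo null sets. -/
def VecEq (μ : Measure X) (ψ χ : Wave X) : Prop :=
  ∀ n, ψ n =ᵐ[nMeasure μ n] χ n

/-- `ψ` represents a vector of finite particle number in the (anti)symmetric Fock space over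
`L²(X, μ)`. -/
structure FiniteParticle (σ : Statistics) (μ : Measure X) (ψ : Wave X) : Prop where
  memLp : ∀ n, MemLp (ψ n) 2 (nMeasure μ n)
  symm : ∀ (n : ℕ) (p : Equiv.Perm (Fin n)),
    ∀ᵐ η ∂(nMeasure μ n), ψ n (fun i => η (p i)) = σ.character n p * ψ n η
  finite : ∃ N : ℕ, ∀ n, N < n → ψ n =ᵐ[nMeasure μ n] 0

/-- The Fock space inner product, antilinear in the first argument. -/
def fockInner (μ : Measure X) (χ ψ : Wave X) : ℂ :=
  ∑' n, ∫ η, conj (χ n η) * ψ n η ∂(nMeasure μ n)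

/-- `A` is a well-defined operator from the finite-particle vectors to themselves. -/
def PreservesDomain (σ : Statistics) (μ : Measure X) (A : Wave X → Wave X) : Prop :=
  (∀ ψ, FiniteParticle σ μ ψ → FiniteParticle σ μ (A ψ)) ∧
  ∀ ψ χ, FiniteParticle σ μ ψ → FiniteParticle σ μ χ → VecEq μ ψ χ → VecEq μ (A ψ) (A χ)

/-- `B` is the Hermitian conjugate of `A` on finite-particle vectors. -/
def IsHermitianConj (σ : Statistics) (μ : Measure X) (A B : Wave X → Wave X) : Prop :=
  ∀ χ ψ, FiniteParticle σ μ χ → FiniteParticle σ μ ψ →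
    fockInner μ χ (A ψ) = fockInner μ (B χ) ψ

/-- `[A, B] = 0` on finite-particle vectors. -/
def CommuteOnFinite (σ : Statistics) (μ : Measure X) (A B : Wave X → Wave X) : Prop :=
  ∀ ψ, FiniteParticle σ μ ψ → VecEq μ (A (B ψ)) (B (A ψ))

end Fock

section Operators

variable {X : Type}

/-- The vacuum vector `Ω`. -/
def vacuum : Wave X := fun n _ => if n = 0 then 1 else 0

/-- The annihilation operator `a(ξ)`. -/
def annihilate (ξ : X) (ψ : Wave X) : Wave X :=
  fun n η => (Real.sqrt (n + 1) : ℂ) * ψ (n + 1) (Fin.cons ξ η)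

/-- `exp (i ∫ v(ξ') a*(ξ') a(ξ') dξ')` -/
def expDensity (v : X → ℝ) (ψ : Wave X) : Wave X :=
  fun n η => Complex.exp (Complex.I * ((∑ j, v (η j) : ℝ) : ℂ)) * ψ n η

/-- `Z(ξ) = a(ξ) exp (-i ∫ u(ξ, ξ') a*(ξ') a(ξ') dξ')` -/
def zPoint (u : X → X → ℝ) (ξ : X) (ψ : Wave X) : Wave X :=
  annihilate ξ (expDensity (fun ξ' => -u ξ ξ') ψ)

/-- `∫ φ(ξ) Z(ξ) dμ(ξ)` -/
def zAnn [MeasurableSpace X] (μ : Measure X) (u : X → X → ℝ) (φ : X → ℂ) (ψ : Wave X) : Wave X :=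
  fun n η => ∫ ξ, φ ξ * zPoint u ξ ψ n η ∂μ

/-- `∫ φ(ξ) Z*(ξ) dμ(ξ)`, where `Z*(ξ) = exp (i ∫ u(ξ, ξ') a*(ξ') a(ξ') dξ') a*(ξ)` and
`(a*(ξ)ψ)ₙ(η) = n^(-1/2) ∑ₖ (±1)ᵏ δ(ξ - ηₖ) ψₙ₋₁(η without ηₖ)`. -/
def zCre (σ : Statistics) (u : X → X → ℝ) (φ : X → ℂ) (ψ : Wave X) : Wave X
  | 0, _ => 0
  | n + 1, η => (Real.sqrt (n + 1) : ℂ)⁻¹ *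
      ∑ k : Fin (n + 1), σ.swapSign k * φ (η k) *
        Complex.exp (Complex.I * ((∑ j, u (η k) (η j) : ℝ) : ℂ)) *
        ψ n (fun j => η (k.succAbove j))

/-- `Z#(φ)`, standing for `∫ φ Z` (`false`) or `∫ φ Z*` (`true`). -/
def zSharp [MeasurableSpace X] (σ : Statistics) (μ : Measure X) (u : X → X → ℝ) :
    Bool → (X → ℂ) → Wave X → Wave X
  | false, φ => zAnn μ u φ
  | true, φ => zCre σ u φ

/-- The smeared free creation operator `∫ φ(ξ) a*(ξ) dξ`. -/
def creation (σ : Statistics) (φ : X → ℂ) : Wave X → Wave X := zCre σ (fun _ _ => 0) φ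

/-- The free (incoming) modular conjugation: complex conjugation together with the charge
conjugation `c`, reversing the order of the particles. On symmetric functions the reversal does
nothing, on antisymmetric ones it gives the factor `(-1)^(n(n-1)/2)` of the Klein
transformation. -/
def freeJ (c : X → X) (ψ : Wave X) : Wave X :=
  fun n η => conj (ψ n (fun i => c (η i.rev)))

/-- The scattering operator with two-particle phases `w`: multiplication of the `n`-particle wave
function by `∏ exp (i w(ηᵢ, ηⱼ))` over all ordered pairs (the kernels below vanish for one of the
two orders, so that every pair is counted once). -/
def scattering (w : X → X → ℝ) (ψ : Wave X) : Wave X :=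
  fun n η => Complex.exp (Complex.I * ((∑ i, ∑ j, w (η i) (η j) : ℝ) : ℂ)) * ψ n η

/-- The interacting modular conjugation `J = S_s J₀`. -/
def modularJ (c : X → X) (w : X → X → ℝ) (ψ : Wave X) : Wave X :=
  scattering w (freeJ c ψ)

/-- `J A J` -/
def conjByJ (J A : Wave X → Wave X) (ψ : Wave X) : Wave X := J (A (J ψ))

end Operators

/-! ### Test functions -/

/-- The right wedge; points are `(x⁰, x¹)`. -/
def wedge : Set (ℝ × ℝ) := {x | |x.1| < x.2}

/-- `f(ζ) = (2π)^(-1/2) ∫ exp (-i p(ζ)x) f̂(x) d²x` with `p₀ = m cosh ζ`, `p₁ = m sinh ζ` and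
`px = p₀ x⁰ + p₁ x¹` (covariant components of `p`, contravariant ones of `x`). -/
def waveFn (m : ℝ) (f : ℝ × ℝ → ℂ) (ζ : ℂ) : ℂ :=
  ((Real.sqrt (2 * Real.pi))⁻¹ : ℂ) *
    ∫ x : ℝ × ℝ, Complex.exp (-Complex.I *
      (m * (Complex.cosh ζ * (x.1 : ℂ) + Complex.sinh ζ * (x.2 : ℂ)))) * f x

/-! ### One self-conjugate particle -/

/-- `S` is the two-particle S-matrix with scattering phase `ϑ`, without bound states: continuous
and bounded on the closed strip `0 ≤ Im ζ ≤ π`, holomorphic inside, unitary, Hermitian analytic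
and crossing symmetric. -/
structure IsTwoParticleS (ϑ : ℝ → ℝ) (S : ℂ → ℂ) : Prop where
  continuousOn : ContinuousOn S {ζ | 0 ≤ ζ.im ∧ ζ.im ≤ Real.pi}
  differentiableOn : DifferentiableOn ℂ S {ζ | 0 < ζ.im ∧ ζ.im < Real.pi}
  bounded : ∃ C : ℝ, ∀ ζ : ℂ, 0 ≤ ζ.im → ζ.im ≤ Real.pi → ‖S ζ‖ ≤ C
  phase : ∀ θ : ℝ, S θ = Complex.exp (Complex.I * ϑ θ)
  unitary : ∀ θ : ℝ, S θ * S (-θ) = 1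
  crossing : ∀ θ : ℝ, S (θ + Real.pi * Complex.I) = S (-θ)

/-- `ϑ(θ - θ')` for `θ' < θ`, and zero otherwise. -/
def phaseBelow (ϑ : ℝ → ℝ) (θ θ' : ℝ) : ℝ := if θ' < θ then ϑ (θ - θ') else 0

/-- `Z(f̂) = ∫ Z(x) f̂(x) d²x = ∫ (f(θ) Z(θ) + f(θ - iπ) Z*(θ)) dθ` with
`Z(θ) = a(θ) exp (-i ∫_{-∞}^θ ϑ(θ - θ') a*(θ') a(θ') dθ')`. -/
def scalarZ (m : ℝ) (ϑ : ℝ → ℝ) (f : ℝ × ℝ → ℂ) (ψ : Wave ℝ) : Wave ℝ :=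
  zAnn volume (phaseBelow ϑ) (fun θ => waveFn m f θ) ψ +
    zCre .bose (phaseBelow ϑ) (fun θ => waveFn m f (θ - Real.pi * Complex.I)) ψ

/-- `J = S_s J₀`, with `S_s` the product of `S(θᵢ - θⱼ)` over the pairs `θᵢ > θⱼ`. -/
def scalarJ (ϑ : ℝ → ℝ) : Wave ℝ → Wave ℝ := modularJ id (phaseBelow ϑ)

/-! ### The Federbush model -/

/-- Rapidity, species (`0` is I, `1` is II) and charge (`true` is a particle, `false` an
antiparticle). -/
abbrev FedLabel : Type := ℝ × Fin 2 × Bool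

def fedMeasure : Measure FedLabel := (volume : Measure ℝ).prod Measure.count

def charge (q : Bool) : ℝ := if q then 1 else -1

def fedConj (ξ : FedLabel) : FedLabel := (ξ.1, ξ.2.1, !ξ.2.2)

/-- The phases in the `Z`-operators: the annihilators for charge `q` are
`a_I(θ) exp (-iπgq ∫_{-∞}^θ ρ_II)` and `a_II(θ) exp (iπgq ∫_{-∞}^θ ρ_I)`, with `ρ` the charge
densities in rapidity space. -/
def fedKernel (g : ℝ) (ξ η : FedLabel) : ℝ :=
  if ξ.2.1 ≠ η.2.1 ∧ η.1 < ξ.1 then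
    (if ξ.2.1 = 0 then 1 else -1) * (Real.pi * g * charge ξ.2.2 * charge η.2.2)
  else 0

/-- The scattering phases: `S_s = exp (iπg ∫∫ ρ_I(θ₁) ρ_II(θ₂) ε(θ₁ - θ₂) dθ₁ dθ₂)`. -/
def fedScattering (g : ℝ) (ξ η : FedLabel) : ℝ :=
  if ξ.2.1 = 0 ∧ η.2.1 = 1 then
    Real.pi * g * charge ξ.2.2 * charge η.2.2 * Real.sign (ξ.1 - η.1)
  else 0

def fedJ (g : ℝ) : Wave FedLabel → Wave FedLabel := modularJ fedConj (fedScattering g)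

/-- The one-particle function `h` of species `s` and charge `q`. -/
def component (s : Fin 2) (q : Bool) (h : ℝ → ℂ) (ξ : FedLabel) : ℂ :=
  if ξ.2 = (s, q) then h ξ.1 else 0

/-- The field of species `s`, smeared: for `q = true` it is `Z_s(f̂)` with
`Z_s(x) = (2π)^(-1/2) ∫ (exp (-ipx) c_s(θ) + exp (ipx) d_s*(θ)) dθ`, for `q = false` it is the
conjugate field `Z_s*(f̂)`. -/
def fedZ (m : Fin 2 → ℝ) (g : ℝ) (s : Fin 2) (q : Bool) (f : ℝ × ℝ → ℂ) (ψ : Wave FedLabel) :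
    Wave FedLabel :=
  zAnn fedMeasure (fedKernel g) (component s q fun θ => waveFn (m s) f θ) ψ +
    zCre .fermi (fedKernel g)
      (component s (!q) fun θ => waveFn (m s) f (θ - Real.pi * Complex.I)) ψ

end FWG

end

open FWG

/-! Everything rests on one picture: the field acts on the particle row from the left, and its
conjugate by `J` acts from the right. In `zAnn` and `zCre` the particle ξ sits at the front and
picks up the phases u(ξ, ηⱼ). The scattering phases w of `J` satisfy w(ξ, η) + w(η, ξ) = u(ξ, η) +
u(η, ξ). Adding a particle therefore multiplies the scattering factor by exp i∑(u(ξ, ηⱼ) + u(ηⱼ,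
ξ)). The first half cancels against the phase of the operator and the second survives. Since `J₀`
reverses the row, `J` turns the operators into `zAnnRight` and `zCreRight`, which work at the far
end with transposed phases (`CompatiblePhases.conjByJ_zAnn`, `CompatiblePhases.conjByJ_zCre`).

Left and right annihilators commute, as do left and right creators, for either statistics: the phase
between the two moving particles is the same in both orders. A mixed pair commutes up to the case
where the particle created is the one annihilated, which gives the multiplication operator
`exchange`. By `CompatiblePhases.commuteOnFinite`, locality thus becomes, for each configuration η,
an equality of two scalar integrals. This part needs only square-integrability; the symmetry of the
wave functions enters in the invariance of the domain and in the Hermitian conjugates.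

For one scalar particle, exp i(u(θ, η) - u(η, θ)) is S(θ - η) in either order of θ and η, by
unitarity. The two integrals are then those of one function, conj f(conj ζ) · g(ζ - iπ) · ∏ S(ζ -
ηⱼ), along the two edges of the strip 0 ≤ Im ζ ≤ π, crossing supplying the upper edge. Support in
the wedge makes the wave functions holomorphic in their strip and integration by parts makes them
decay like exp(-|Re ζ|), so the contour may be shifted (`integral_waveFn_crossing`).

In the Federbush model the phase does not depend on θ, so the same shift with a constant in place of
S settles equal fields. For different fields the one-particle functions have disjoint supports and
both integrals vanish, for different species without any localization. -/

noncomputable section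

set_option linter.unusedSectionVars false

namespace FWG

/-! ### Square-integrable functions on products -/

section Product

variable {X Y : Type} [MeasurableSpace X] [MeasurableSpace Y] {μ : Measure X} {ν : Measure Y}

lemma memLp_two_mul_prod [SFinite μ] [SFinite ν] {φ : X → ℂ} {ψ : Y → ℂ} (hφ : MemLp φ 2 μ)
    (hψ : MemLp ψ 2 ν) : MemLp (fun z : X × Y => φ z.1 * ψ z.2) 2 (μ.prod ν) := by
  have hm : AEStronglyMeasurable (fun z : X × Y => φ z.1 * ψ z.2) (μ.prod ν) :=
    hφ.1.comp_fst.mul hψ.1.comp_snd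
  rw [memLp_two_iff_integrable_sq_norm hm]
  have h1 := (memLp_two_iff_integrable_sq_norm hφ.1).1 hφ
  have h2 := (memLp_two_iff_integrable_sq_norm hψ.1).1 hψ
  refine (h1.mul_prod h2).congr (.of_forall fun z => ?_)
  simp [mul_pow]

lemma MemLp.ae_slice_left [SFinite μ] [SFinite ν] {G : X × Y → ℂ} (hG : MemLp G 2 (μ.prod ν)) :
    ∀ᵐ y ∂ν, MemLp (fun x => G (x, y)) 2 μ := by
  have hs : MemLp (fun z : Y × X => G z.swap) 2 (ν.prod μ) :=
    hG.comp_measurePreserving Measure.measurePreserving_swap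
  have h1 := ((memLp_two_iff_integrable_sq_norm hs.1).1 hs).prod_right_ae
  filter_upwards [h1, hs.1.prodMk_left] with y h1 h2
  exact (memLp_two_iff_integrable_sq_norm h2).2 h1

lemma norm_integral_mul_sq_le {φ G : X → ℂ} (hφ : MemLp φ 2 μ) (hG : MemLp G 2 μ) :
    ‖∫ x, φ x * G x ∂μ‖ ^ 2 ≤ (∫ x, ‖φ x‖ ^ 2 ∂μ) * ∫ x, ‖G x‖ ^ 2 ∂μ := by
  have h := integral_mul_norm_le_Lp_mul_Lq (μ := μ) (f := φ) (g := G) Real.HolderConjugate.two_two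
    (by simpa using hφ) (by simpa using hG)
  have h1 : ‖∫ x, φ x * G x ∂μ‖ ≤ ∫ x, ‖φ x‖ * ‖G x‖ ∂μ := by
    refine (norm_integral_le_integral_norm _).trans_eq ?_
    simp
  have h2 := h1.trans h
  simp only [← Nat.cast_ofNat (R := ℝ) (n := 2), Real.rpow_natCast] at h2
  have h3 := pow_le_pow_left₀ (norm_nonneg _) h2 2
  refine h3.trans_eq ?_
  have a : ∀ t : ℝ, 0 ≤ t → (t ^ (1 / ((2 : ℕ) : ℝ))) ^ 2 = t := fun t ht => by
    rw [← Real.rpow_natCast, ← Real.rpow_mul ht]; simp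
  rw [mul_pow, a _ (integral_nonneg fun _ => by positivity),
    a _ (integral_nonneg fun _ => by positivity)]

/-- Cauchy–Schwarz on each slice, then Fubini for the squared norm. This is what keeps annihilation
operators inside the square-integrable wave functions. -/
lemma memLp_integral_mul [SFinite μ] [SFinite ν] {φ : X → ℂ} {G : X × Y → ℂ} (hφ : MemLp φ 2 μ)
    (hG : MemLp G 2 (μ.prod ν)) : MemLp (fun y => ∫ x, φ x * G (x, y) ∂μ) 2 ν := by
  have hs : MemLp (fun z : Y × X => G z.swap) 2 (ν.prod μ) :=
    hG.comp_measurePreserving Measure.measurePreserving_swap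
  have hm : AEStronglyMeasurable (fun y => ∫ x, φ x * G (x, y) ∂μ) ν :=
    AEStronglyMeasurable.integral_prod_right' (f := fun z : Y × X => φ z.2 * G z.swap)
      (hφ.1.comp_snd.mul hs.1)
  rw [memLp_two_iff_integrable_sq_norm hm]
  have h2 := ((memLp_two_iff_integrable_sq_norm hs.1).1 hs).integral_prod_left
  refine (h2.const_mul (∫ x, ‖φ x‖ ^ 2 ∂μ)).mono' (hm.norm.pow 2) ?_
  filter_upwards [MemLp.ae_slice_left hG] with y hy
  simpa using norm_integral_mul_sq_le hφ hy

/-- Multiplication by a measurable phase. -/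
lemma MemLp.phase_mul {F : X → ℂ} (hF : MemLp F 2 μ) {v : X → ℝ}
    (hv : Measurable fun x => Complex.exp (Complex.I * (v x : ℂ))) :
    MemLp (fun x => Complex.exp (Complex.I * (v x : ℂ)) * F x) 2 μ := by
  refine hF.of_le (hv.aestronglyMeasurable.mul hF.1) (.of_forall fun x => ?_)
  rw [norm_mul, mul_comm Complex.I, Complex.norm_exp_ofReal_mul_I, one_mul]

end Product

/-! ### Splitting off one particle -/

section Insert

variable {X : Type} [MeasurableSpace X] {μ : Measure X}

instance [SigmaFinite μ] (n : ℕ) : SigmaFinite (nMeasure μ n) := by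
  unfold nMeasure; infer_instance

/-- Insertion of a particle at position `k`. -/
def insertEquiv (X : Type) [MeasurableSpace X] {n : ℕ} (k : Fin (n + 1)) :
    X × (Fin n → X) ≃ᵐ (Fin (n + 1) → X) :=
  (MeasurableEquiv.piFinSuccAbove (fun _ => X) k).symm

lemma insertEquiv_apply {n : ℕ} (k : Fin (n + 1)) (z : X × (Fin n → X)) :
    insertEquiv X k z = k.insertNth z.1 z.2 := rfl

lemma insertEquiv_zero {n : ℕ} (z : X × (Fin n → X)) :
    insertEquiv X 0 z = Fin.cons z.1 z.2 := by
  rw [insertEquiv_apply, Fin.insertNth_zero']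

lemma insertEquiv_last {n : ℕ} (z : X × (Fin n → X)) :
    insertEquiv X (Fin.last n) z = Fin.snoc z.2 z.1 := by
  rw [insertEquiv_apply, Fin.insertNth_last']

lemma insertEquiv_symm_apply {n : ℕ} (k : Fin (n + 1)) (η : Fin (n + 1) → X) :
    (insertEquiv X k).symm η = (η k, fun j => η (k.succAbove j)) := rfl

variable [SigmaFinite μ]

lemma measurePreserving_insertEquiv_symm {n : ℕ} (k : Fin (n + 1)) :
    MeasurePreserving (insertEquiv X k).symm (nMeasure μ (n + 1)) (μ.prod (nMeasure μ n)) :=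
  measurePreserving_piFinSuccAbove (fun _ => μ) k

lemma measurePreserving_insertEquiv {n : ℕ} (k : Fin (n + 1)) :
    MeasurePreserving (insertEquiv X k) (μ.prod (nMeasure μ n)) (nMeasure μ (n + 1)) :=
  (measurePreserving_insertEquiv_symm k).symm _

lemma measurePreserving_comp_perm {n : ℕ} (p : Equiv.Perm (Fin n)) :
    MeasurePreserving (fun η : Fin n → X => fun i => η (p i)) (nMeasure μ n) (nMeasure μ n) := by
  have h := measurePreserving_arrowCongr' (fun _ : Fin n => μ) (fun _ : Fin n => μ) p.symm
    (MeasurableEquiv.refl X) (fun _ => MeasurePreserving.id μ)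
  exact h

lemma measurePreserving_comp_left {n : ℕ} {c : X → X} (hc : MeasurePreserving c μ μ) :
    MeasurePreserving (fun η : Fin n → X => fun i => c (η i)) (nMeasure μ n) (nMeasure μ n) :=
  measurePreserving_pi _ _ fun _ => hc

lemma quasiMeasurePreserving_succAbove {n : ℕ} (k : Fin (n + 1)) :
    Measure.QuasiMeasurePreserving (fun η : Fin (n + 1) → X => fun j => η (k.succAbove j))
      (nMeasure μ (n + 1)) (nMeasure μ n) :=
  Measure.quasiMeasurePreserving_snd.comp
    (measurePreserving_insertEquiv_symm k).quasiMeasurePreserving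

lemma ae_ae_insert {n : ℕ} (k : Fin (n + 1)) {P : (Fin (n + 1) → X) → Prop}
    (h : ∀ᵐ η ∂(nMeasure μ (n + 1)), P η) :
    ∀ᵐ η ∂(nMeasure μ n), ∀ᵐ ξ ∂μ, P (insertEquiv X k (ξ, η)) := by
  have h1 := (measurePreserving_insertEquiv (μ := μ) k).quasiMeasurePreserving.ae h
  exact Measure.ae_ae_of_ae_prod (Measure.measurePreserving_swap.quasiMeasurePreserving.ae h1)

end Insert

/-! ### Phases -/

section Phase

variable {X : Type} [MeasurableSpace X]

/-- The phase factor of the kernel `u` is jointly measurable. -/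
def MeasurablePhase (u : X → X → ℝ) : Prop :=
  Measurable fun z : X × X => Complex.exp (Complex.I * (u z.1 z.2 : ℂ))

lemma measurable_exp_sum {ι Y : Type} [MeasurableSpace Y] (s : Finset ι) {v : ι → Y → ℝ}
    (h : ∀ i ∈ s, Measurable fun y => Complex.exp (Complex.I * (v i y : ℂ))) :
    Measurable fun y => Complex.exp (Complex.I * ((∑ i ∈ s, v i y : ℝ) : ℂ)) := by
  have : (fun y => Complex.exp (Complex.I * ((∑ i ∈ s, v i y : ℝ) : ℂ))) =
      fun y => ∏ i ∈ s, Complex.exp (Complex.I * (v i y : ℂ)) := by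
    funext y
    rw [← Complex.exp_sum]; push_cast; rw [Finset.mul_sum]
  rw [this]
  exact Finset.measurable_fun_prod _ h

lemma measurable_exp_neg {Y : Type} [MeasurableSpace Y] {v : Y → ℝ}
    (h : Measurable fun y => Complex.exp (Complex.I * (v y : ℂ))) :
    Measurable fun y => Complex.exp (Complex.I * ((-v y : ℝ) : ℂ)) := by
  have : (fun y => Complex.exp (Complex.I * ((-v y : ℝ) : ℂ))) =
      fun y => (Complex.exp (Complex.I * (v y : ℂ)))⁻¹ := by
    funext y
    rw [← Complex.exp_neg]; push_cast; ring_nf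
  rw [this]
  exact h.inv

lemma measurable_exp_add {Y : Type} [MeasurableSpace Y] {v w : Y → ℝ}
    (hv : Measurable fun y => Complex.exp (Complex.I * (v y : ℂ)))
    (hw : Measurable fun y => Complex.exp (Complex.I * (w y : ℂ))) :
    Measurable fun y => Complex.exp (Complex.I * ((v y + w y : ℝ) : ℂ)) := by
  have : (fun y => Complex.exp (Complex.I * ((v y + w y : ℝ) : ℂ))) =
      fun y => Complex.exp (Complex.I * (v y : ℂ)) * Complex.exp (Complex.I * (w y : ℂ)) := by
    funext y
    rw [← Complex.exp_add]; push_cast; ring_nf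
  rw [this]
  exact hv.mul hw

lemma MeasurablePhase.comp {u : X → X → ℝ} (hu : MeasurablePhase u) {Y : Type} [MeasurableSpace Y]
    {a b : Y → X} (ha : Measurable a) (hb : Measurable b) :
    Measurable fun y => Complex.exp (Complex.I * (u (a y) (b y) : ℂ)) :=
  Measurable.comp (g := fun z : X × X => Complex.exp (Complex.I * (u z.1 z.2 : ℂ))) hu
    (ha.prodMk hb)

lemma MeasurablePhase.swap {u : X → X → ℝ} (hu : MeasurablePhase u) :
    MeasurablePhase fun ξ η => u η ξ :=
  hu.comp measurable_snd measurable_fst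

end Phase

/-! ### The smeared operators on sequences of square-integrable functions -/

section Domain

variable {X : Type} [MeasurableSpace X] {μ : Measure X} [SigmaFinite μ] {u w : X → X → ℝ}
  {φ : X → ℂ} {ψ χ : Wave X} {σ : Statistics}

/-- All `n`-particle components are square-integrable. -/
def SqInt (μ : Measure X) (ψ : Wave X) : Prop := ∀ n, MemLp (ψ n) 2 (nMeasure μ n)

/-- The density phase acts before the particle is removed and so includes the particle itself; the
vanishing diagonal leaves only the remaining ones. -/
lemma zAnn_apply (hd : ∀ ξ, u ξ ξ = 0) (n : ℕ) (η : Fin n → X) :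
    zAnn μ u φ ψ n η = (Real.sqrt (n + 1) : ℂ) * ∫ ξ, φ ξ *
      (Complex.exp (Complex.I * ((-∑ j, u ξ (η j) : ℝ) : ℂ)) *
        ψ (n + 1) (Fin.cons ξ η : Fin (n + 1) → X)) ∂μ := by
  simp only [zAnn, zPoint, annihilate, expDensity]
  rw [← integral_const_mul]
  congr 1
  funext ξ
  rw [Fin.sum_univ_succ]
  simp only [Fin.cons_zero, Fin.cons_succ, hd, neg_zero, zero_add, Finset.sum_neg_distrib]
  ring

lemma memLp_annihilated (hu : MeasurablePhase u) (hψ : SqInt μ ψ) (n : ℕ) :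
    MemLp (fun z : X × (Fin n → X) => Complex.exp (Complex.I * ((-∑ j, u z.1 (z.2 j) : ℝ) : ℂ)) *
        ψ (n + 1) (Fin.cons z.1 z.2 : Fin (n + 1) → X)) 2 (μ.prod (nMeasure μ n)) := by
  have h := (hψ (n + 1)).comp_measurePreserving (measurePreserving_insertEquiv (μ := μ) 0)
  have h' : MemLp (fun z : X × (Fin n → X) => ψ (n + 1) (Fin.cons z.1 z.2 : Fin (n + 1) → X)) 2
      (μ.prod (nMeasure μ n)) := by
    refine h.ae_eq (.of_forall fun z => ?_)
    simp only [Function.comp, insertEquiv_zero]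
  refine MemLp.phase_mul h' (v := fun z : X × (Fin n → X) => -∑ j, u z.1 (z.2 j)) ?_
  exact measurable_exp_neg (measurable_exp_sum _ fun j _ => hu.comp (by fun_prop) (by fun_prop))

lemma SqInt.zAnn (hd : ∀ ξ, u ξ ξ = 0) (hu : MeasurablePhase u) (hφ : MemLp φ 2 μ)
    (hψ : SqInt μ ψ) : SqInt μ (zAnn μ u φ ψ) := by
  intro n
  have h := (memLp_integral_mul hφ (memLp_annihilated hu hψ n)).const_mul (Real.sqrt (n + 1) : ℂ)
  refine h.ae_eq (.of_forall fun η => ?_)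
  exact (zAnn_apply hd n η).symm

lemma VecEq.zAnn (hd : ∀ ξ, u ξ ξ = 0) (h : VecEq μ ψ χ) :
    VecEq μ (zAnn μ u φ ψ) (zAnn μ u φ χ) := by
  intro n
  filter_upwards [ae_ae_insert 0 (h (n + 1))] with η hη
  rw [zAnn_apply hd, zAnn_apply hd]
  congr 1
  refine integral_congr_ae ?_
  filter_upwards [hη] with ξ hξ
  rw [insertEquiv_zero] at hξ
  rw [hξ]

/-- Additivity holds only up to null sets: the slices over η are square-integrable, hence the
integrals additive, only for almost every η. For creators it is an identity. -/
lemma zAnn_add (hd : ∀ ξ, u ξ ξ = 0) (hu : MeasurablePhase u) (hφ : MemLp φ 2 μ)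
    (hψ : SqInt μ ψ) (hχ : SqInt μ χ) :
    VecEq μ (FWG.zAnn μ u φ (ψ + χ)) (FWG.zAnn μ u φ ψ + FWG.zAnn μ u φ χ) := by
  intro n
  filter_upwards [MemLp.ae_slice_left (memLp_annihilated hu hψ n),
    MemLp.ae_slice_left (memLp_annihilated hu hχ n)] with η h1 h2
  simp only [Pi.add_apply, zAnn_apply hd]
  have h := integral_add (hφ.integrable_mul h1) (hφ.integrable_mul h2)
  simp only [Pi.mul_apply] at h
  rw [← mul_add, ← h]
  congr 2
  funext ξ
  ring

lemma memLp_created (hu : MeasurablePhase u) (hφ : MemLp φ 2 μ) (hψ : SqInt μ ψ) {n : ℕ}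
    (k : Fin (n + 1)) :
    MemLp (fun η : Fin (n + 1) → X => σ.swapSign k * φ (η k) *
      Complex.exp (Complex.I * ((∑ j, u (η k) (η j) : ℝ) : ℂ)) *
      ψ n (fun j => η (k.succAbove j))) 2 (nMeasure μ (n + 1)) := by
  have h := (memLp_two_mul_prod hφ (hψ n)).comp_measurePreserving
    (measurePreserving_insertEquiv_symm (μ := μ) k)
  have h2 := (MemLp.phase_mul h (v := fun η : Fin (n + 1) → X => ∑ j, u (η k) (η j))
    (measurable_exp_sum _ fun j _ =>
      hu.comp (measurable_pi_apply k) (measurable_pi_apply j))).const_mul (σ.swapSign k)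
  refine h2.ae_eq (.of_forall fun η => ?_)
  simp only [Function.comp, insertEquiv_symm_apply]
  ring

lemma SqInt.zCre (hu : MeasurablePhase u) (hφ : MemLp φ 2 μ) (hψ : SqInt μ ψ) :
    SqInt μ (zCre σ u φ ψ) := by
  intro n
  cases n with
  | zero => exact MemLp.zero'
  | succ n =>
    exact (memLp_finsetSum Finset.univ fun k _ => memLp_created hu hφ hψ k).const_mul
      (Real.sqrt (n + 1) : ℂ)⁻¹

lemma VecEq.zCre (h : VecEq μ ψ χ) : VecEq μ (zCre σ u φ ψ) (zCre σ u φ χ) := by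
  intro n
  cases n with
  | zero => exact .rfl
  | succ n =>
    have h1 : ∀ᵐ η ∂(nMeasure μ (n + 1)), ∀ k : Fin (n + 1),
        ψ n (fun j => η (k.succAbove j)) = χ n (fun j => η (k.succAbove j)) :=
      ae_all_iff.2 fun k => (quasiMeasurePreserving_succAbove k).ae (h n)
    filter_upwards [h1] with η hη
    simp only [FWG.zCre, hη]

lemma zCre_add : zCre σ u φ (ψ + χ) = zCre σ u φ ψ + zCre σ u φ χ := by
  funext n η
  cases n with
  | zero => simp [zCre]
  | succ n =>
    simp only [zCre, Pi.add_apply, mul_add, Finset.sum_add_distrib]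

lemma scattering_add (w : X → X → ℝ) : scattering w (ψ + χ) = scattering w ψ + scattering w χ := by
  funext n η; simp only [scattering, Pi.add_apply, mul_add]

lemma freeJ_add (c : X → X) : freeJ c (ψ + χ) = freeJ c ψ + freeJ c χ := by
  funext n η; simp only [freeJ, Pi.add_apply, map_add]

lemma modularJ_add (c : X → X) (w : X → X → ℝ) :
    modularJ c w (ψ + χ) = modularJ c w ψ + modularJ c w χ := by
  simp only [modularJ, freeJ_add, scattering_add]

lemma measurePreserving_conjRev {c : X → X} (hc : MeasurePreserving c μ μ) (n : ℕ) :
    MeasurePreserving (fun η : Fin n → X => fun i => c (η i.rev)) (nMeasure μ n) (nMeasure μ n) :=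
  (measurePreserving_comp_left hc).comp (measurePreserving_comp_perm Fin.revPerm)

lemma SqInt.modularJ {c : X → X} (hc : MeasurePreserving c μ μ) (hw : MeasurablePhase w)
    (hψ : SqInt μ ψ) : SqInt μ (modularJ c w ψ) := by
  intro n
  refine MemLp.phase_mul (v := fun η : Fin n → X => ∑ i, ∑ j, w (η i) (η j)) ?_
    (measurable_exp_sum _ fun i _ => measurable_exp_sum _ fun j _ =>
      hw.comp (measurable_pi_apply i) (measurable_pi_apply j))
  exact ((hψ n).comp_measurePreserving (measurePreserving_conjRev hc n)).star

lemma VecEq.modularJ {c : X → X} (hc : MeasurePreserving c μ μ) (h : VecEq μ ψ χ) :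
    VecEq μ (modularJ c w ψ) (modularJ c w χ) := by
  intro n
  filter_upwards [(measurePreserving_conjRev hc n).quasiMeasurePreserving.ae (h n)] with η hη
  simp only [FWG.modularJ, scattering, freeJ, hη]

lemma VecEq.add {ψ' χ' : Wave X} (h : VecEq μ ψ χ) (h' : VecEq μ ψ' χ') :
    VecEq μ (ψ + ψ') (χ + χ') :=
  fun n => (h n).add (h' n)

/-! ### Statistics -/

lemma character_mul (n : ℕ) (p q : Equiv.Perm (Fin n)) :
    σ.character n (p * q) = σ.character n p * σ.character n q := by
  cases σ <;> simp [Statistics.character]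

lemma character_cycleRange {n : ℕ} (k : Fin (n + 1)) :
    σ.character (n + 1) k.cycleRange = σ.swapSign k := by
  cases σ <;> simp [Statistics.character, Statistics.swapSign, Fin.sign_cycleRange]

lemma character_decomposeFin {n : ℕ} (e : Equiv.Perm (Fin n)) :
    σ.character (n + 1) (Equiv.Perm.decomposeFin.symm (0, e)) = σ.character n e := by
  cases σ <;> simp [Statistics.character, Equiv.Perm.decomposeFin.symm_sign]

lemma swapSign_add (i j : ℕ) : σ.swapSign (i + j) = σ.swapSign i * σ.swapSign j := by
  cases σ <;> simp [Statistics.swapSign, pow_add]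

lemma swapSign_mul_self (i : ℕ) : σ.swapSign i * σ.swapSign i = 1 := by
  cases σ <;> simp [Statistics.swapSign, ← mul_pow]

lemma conj_swapSign (i : ℕ) : conj (σ.swapSign i) = σ.swapSign i := by
  cases σ <;> simp [Statistics.swapSign]

lemma conj_character (n : ℕ) (p : Equiv.Perm (Fin n)) :
    conj (σ.character n p) = σ.character n p := by
  cases σ <;> simp [Statistics.character]

lemma character_revConj (n : ℕ) (p : Equiv.Perm (Fin n)) :
    σ.character n (Fin.revPerm * p * Fin.revPerm) = σ.character n p := by
  rw [character_mul, character_mul, mul_right_comm, ← character_mul]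
  have : (Fin.revPerm * Fin.revPerm : Equiv.Perm (Fin n)) = 1 := by
    ext i; simp
  rw [this]
  cases σ <;> simp [Statistics.character]

/-- Moving a particle from position k to the front is a cycle, whose character is `swapSign k`; this
matches the signs of `zCre` with the symmetry of wave functions. -/
lemma insertNth_eq_cons_cycleRange {n : ℕ} (k : Fin (n + 1)) (ξ : X) (η : Fin n → X) :
    (k.insertNth ξ η : Fin (n + 1) → X) =
      fun i => (Fin.cons ξ η : Fin (n + 1) → X) (k.cycleRange i) := by
  funext i
  refine Fin.succAboveCases k ?_ (fun j => ?_) i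
  · simp
  · simp [Fin.cycleRange_succAbove]

/-- A permutation of `n + 1` particles induces one of the remaining `n` when a particle is
removed. -/
lemma exists_perm_succAbove {n : ℕ} (p : Equiv.Perm (Fin (n + 1))) (k : Fin (n + 1)) :
    ∃ e : Equiv.Perm (Fin n), (∀ j, p (k.succAbove j) = (p k).succAbove (e j)) ∧
      ∀ σ : Statistics, σ.swapSign k * σ.character n e =
        σ.character (n + 1) p * σ.swapSign (p k) := by
  -- Bringing k and p k to the front makes the permutation fix 0, so it comes from one of the other
  -- n particles; the two cycles account for the signs.
  set q : Equiv.Perm (Fin (n + 1)) := (p k).cycleRange * p * k.cycleRange⁻¹ with hq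
  obtain ⟨⟨a, e⟩, he⟩ := Equiv.Perm.decomposeFin.symm.surjective q
  have hq0 : q 0 = 0 := by
    simp [hq]
  have ha : a = 0 := by
    have := Equiv.Perm.decomposeFin_symm_apply_zero a e
    rw [he, hq0] at this; exact this.symm
  subst ha
  refine ⟨e, fun j => ?_, fun σ => ?_⟩
  · have h1 : q j.succ = (e j).succ := by
      rw [← he, Equiv.Perm.decomposeFin_symm_apply_succ]; simp
    have h2 : k.cycleRange⁻¹ j.succ = k.succAbove j := by
      rw [Equiv.Perm.inv_eq_iff_eq, Fin.cycleRange_succAbove]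
    rw [hq, Equiv.Perm.mul_apply, Equiv.Perm.mul_apply, h2] at h1
    apply (p k).cycleRange.injective
    rw [h1, Fin.cycleRange_succAbove]
  · have h : q * k.cycleRange = (p k).cycleRange * p := by simp [hq]
    have h2 := congrArg (σ.character (n + 1)) h
    rw [← he, character_mul, character_mul, character_decomposeFin, character_cycleRange,
      character_cycleRange] at h2
    rw [mul_comm, h2, mul_comm]

/-! ### Invariance of the domain -/

lemma FiniteParticle.add (hψ : FiniteParticle σ μ ψ) (hχ : FiniteParticle σ μ χ) :
    FiniteParticle σ μ (ψ + χ) where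
  memLp n := (hψ.memLp n).add (hχ.memLp n)
  symm n p := by
    filter_upwards [hψ.symm n p, hχ.symm n p] with η h1 h2
    simp only [Pi.add_apply, h1, h2, mul_add]
  finite := by
    obtain ⟨N, hN⟩ := hψ.finite
    obtain ⟨M, hM⟩ := hχ.finite
    refine ⟨max N M, fun n hn => ?_⟩
    have := (hN n (by omega)).add (hM n (by omega))
    simpa using this

lemma FiniteParticle.zAnn (hd : ∀ ξ, u ξ ξ = 0) (hu : MeasurablePhase u) (hφ : MemLp φ 2 μ)
    (hψ : FiniteParticle σ μ ψ) : FiniteParticle σ μ (zAnn μ u φ ψ) where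
  memLp := SqInt.zAnn hd hu hφ hψ.memLp
  symm n p := by
    filter_upwards [ae_ae_insert 0 (hψ.symm (n + 1) (Equiv.Perm.decomposeFin.symm (0, p)))]
      with η hη
    rw [zAnn_apply hd, zAnn_apply hd, mul_left_comm]
    congr 1
    rw [← integral_const_mul (σ.character n p)]
    refine integral_congr_ae ?_
    filter_upwards [hη] with ξ hξ
    rw [character_decomposeFin, insertEquiv_zero] at hξ
    have h1 : (fun i => (Fin.cons ξ η : Fin (n + 1) → X)
        (Equiv.Perm.decomposeFin.symm (0, p) i)) = Fin.cons ξ fun i => η (p i) := by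
      funext i
      refine Fin.cases ?_ (fun j => ?_) i
      · simp
      · simp
    rw [h1] at hξ
    rw [hξ, Equiv.sum_comp p fun j => u ξ (η j)]
    ring
  finite := by
    obtain ⟨N, hN⟩ := hψ.finite
    refine ⟨N, fun n hn => ?_⟩
    filter_upwards [ae_ae_insert 0 (hN (n + 1) (by omega))] with η hη
    rw [zAnn_apply hd, Pi.zero_apply]
    refine mul_eq_zero_of_right _ (integral_eq_zero_of_ae ?_)
    filter_upwards [hη] with ξ hξ
    rw [insertEquiv_zero] at hξ
    simp [hξ]

lemma FiniteParticle.zCre (hu : MeasurablePhase u) (hφ : MemLp φ 2 μ)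
    (hψ : FiniteParticle σ μ ψ) : FiniteParticle σ μ (zCre σ u φ ψ) where
  memLp := SqInt.zCre hu hφ hψ.memLp
  symm n p := by
    cases n with
    | zero => simp [FWG.zCre]
    | succ n =>
      choose e he hs using fun k => exists_perm_succAbove p k
      have h1 : ∀ᵐ η ∂(nMeasure μ (n + 1)), ∀ k : Fin (n + 1),
          ψ n (fun j => η ((p k).succAbove (e k j))) =
            σ.character n (e k) * ψ n (fun j => η ((p k).succAbove j)) :=
        ae_all_iff.2 fun k => (quasiMeasurePreserving_succAbove (p k)).ae (hψ.symm n (e k))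
      filter_upwards [h1] with η hη
      simp only [FWG.zCre, he, hη]
      rw [mul_left_comm]
      congr 1
      rw [← Equiv.sum_comp p (fun k => σ.swapSign k * φ (η k) *
        Complex.exp (Complex.I * ((∑ j, u (η k) (η j) : ℝ) : ℂ)) *
        ψ n (fun j => η (k.succAbove j))), Finset.mul_sum]
      refine Finset.sum_congr rfl fun k _ => ?_
      rw [Equiv.sum_comp p fun j => u (η (p k)) (η j)]
      linear_combination (φ (η (p k)) * Complex.exp (Complex.I * ((∑ j, u (η (p k)) (η j) : ℝ) : ℂ))
        * ψ n (fun j => η ((p k).succAbove j))) * hs k σ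
  finite := by
    obtain ⟨N, hN⟩ := hψ.finite
    refine ⟨N + 1, fun n hn => ?_⟩
    obtain ⟨n, rfl⟩ : ∃ k, n = k + 1 := ⟨n - 1, by omega⟩
    -- The creator at level n + 1 sees only the n-particle component, so ψ may be truncated to that
    -- component, and the truncated vector is null at every level.
    have h := VecEq.zCre (μ := μ) (σ := σ) (u := u) (φ := φ)
      (ψ := fun k => if k = n then ψ k else 0) (χ := 0)
      (fun k => by
        by_cases hk : k = n
        · subst hk
          simpa using hN k (by omega)
        · simp [hk]) (n + 1)
    refine Filter.EventuallyEq.trans (.of_forall fun η => ?_)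
      (h.trans (.of_forall fun η => ?_))
    · simp [FWG.zCre]
    · simp [FWG.zCre]

lemma FiniteParticle.modularJ {c : X → X} (hc : MeasurePreserving c μ μ) (hw : MeasurablePhase w)
    (hψ : FiniteParticle σ μ ψ) : FiniteParticle σ μ (modularJ c w ψ) where
  memLp := SqInt.modularJ hc hw hψ.memLp
  symm n p := by
    filter_upwards [(measurePreserving_conjRev hc n).quasiMeasurePreserving.ae
      (hψ.symm n (Fin.revPerm * p * Fin.revPerm))] with η hη
    rw [character_revConj] at hη
    simp only [FWG.modularJ, scattering, freeJ]
    -- After the reversal, p acts as its conjugate by the reversal, which has the same character.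
    have h2 : (fun i : Fin n => c (η (p i.rev))) =
        fun i => c (η ((Fin.revPerm * p * Fin.revPerm : Equiv.Perm (Fin n)) i).rev) := by
      funext i; simp
    rw [h2, hη, map_mul, conj_character, Equiv.sum_comp p fun i => ∑ j, w (η i) (η (p j))]
    have h3 : ∀ i, ∑ j, w (η i) (η (p j)) = ∑ j, w (η i) (η j) :=
      fun i => Equiv.sum_comp p fun j => w (η i) (η j)
    simp only [h3]
    ring
  finite := by
    obtain ⟨N, hN⟩ := hψ.finite
    refine ⟨N, fun n hn => ?_⟩
    filter_upwards [(measurePreserving_conjRev hc n).quasiMeasurePreserving.ae (hN n hn)]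
      with η hη
    simp [FWG.modularJ, scattering, freeJ, hη]

lemma preservesDomain_modularJ {c : X → X} (hc : MeasurePreserving c μ μ)
    (hw : MeasurablePhase w) : PreservesDomain σ μ (modularJ c w) :=
  ⟨fun _ => FiniteParticle.modularJ hc hw, fun _ _ _ _ => VecEq.modularJ hc⟩

lemma preservesDomain_zAnn_add_zCre {φ' : X → ℂ} (hd : ∀ ξ, u ξ ξ = 0) (hu : MeasurablePhase u)
    (hφ : MemLp φ 2 μ) (hφ' : MemLp φ' 2 μ) :
    PreservesDomain σ μ fun ψ => zAnn μ u φ ψ + zCre σ u φ' ψ :=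
  ⟨fun _ h => (h.zAnn hd hu hφ).add (h.zCre hu hφ'),
    fun _ _ _ _ h => (VecEq.zAnn hd h).add (VecEq.zCre h)⟩

end Domain

/-! ### Hermitian conjugates -/

section Hermitian

variable {X : Type} [MeasurableSpace X] {μ : Measure X} [SigmaFinite μ] {u : X → X → ℝ}
  {φ φ' : X → ℂ} {ψ χ : Wave X} {σ : Statistics}

lemma conj_exp_I_mul (t : ℝ) :
    conj (Complex.exp (Complex.I * (t : ℂ))) = Complex.exp (Complex.I * ((-t : ℝ) : ℂ)) := by
  rw [← Complex.exp_conj]; simp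

lemma conj_fockInner (χ ψ : Wave X) : conj (fockInner μ χ ψ) = fockInner μ ψ χ := by
  simp only [fockInner, Complex.conj_tsum, ← integral_conj, map_mul, Complex.conj_conj]
  simp only [mul_comm]

lemma integrable_conj_mul {n : ℕ} (hχ : SqInt μ χ) (hψ : SqInt μ ψ) :
    Integrable (fun η => conj (χ n η) * ψ n η) (nMeasure μ n) :=
  (hχ n).star.integrable_mul (hψ n)

/-- Finiteness of χ alone reduces both series to finite sums, so no summability has to be known for
the other argument. -/
lemma fockInner_add_right (hχ : FiniteParticle σ μ χ) {ψ₁ ψ₂ : Wave X} (h₁ : SqInt μ ψ₁)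
    (h₂ : SqInt μ ψ₂) : fockInner μ χ (ψ₁ + ψ₂) = fockInner μ χ ψ₁ + fockInner μ χ ψ₂ := by
  obtain ⟨N, hN⟩ := hχ.finite
  have hs : ∀ ψ : Wave X, Summable fun n => ∫ η, conj (χ n η) * ψ n η ∂(nMeasure μ n) := by
    intro ψ
    refine summable_of_ne_finset_zero (s := Finset.range (N + 1)) fun n hn => ?_
    refine integral_eq_zero_of_ae ?_
    filter_upwards [hN n (by simpa using hn)] with η hη
    simp [hη]
  unfold fockInner
  rw [← (hs ψ₁).tsum_add (hs ψ₂)]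
  congr 1
  funext n
  rw [← integral_add (integrable_conj_mul hχ.memLp h₁) (integrable_conj_mul hχ.memLp h₂)]
  simp only [Pi.add_apply, mul_add]

lemma integral_conj_mul_zAnn (hd : ∀ ξ, u ξ ξ = 0) (hu : MeasurablePhase u) (hφ : MemLp φ 2 μ)
    (hχ : SqInt μ χ) (hψ : SqInt μ ψ) (n : ℕ) :
    ∫ η, conj (χ n η) * zAnn μ u φ ψ n η ∂(nMeasure μ n) =
      (Real.sqrt (n + 1) : ℂ) * ∫ z : X × (Fin n → X), φ z.1 * conj (χ n z.2) *
        (Complex.exp (Complex.I * ((-∑ j, u z.1 (z.2 j) : ℝ) : ℂ)) *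
          ψ (n + 1) (Fin.cons z.1 z.2 : Fin (n + 1) → X)) ∂(μ.prod (nMeasure μ n)) := by
  have hi := (memLp_two_mul_prod hφ (hχ n).star).integrable_mul (memLp_annihilated hu hψ n)
  have h := integral_prod_symm _ hi
  simp only [Pi.mul_apply, Pi.star_apply, RCLike.star_def] at h
  rw [h, ← integral_const_mul]
  congr 1
  funext η
  rw [zAnn_apply hd, mul_left_comm, ← integral_const_mul]
  congr 2
  funext ξ
  ring

/-- By the symmetry of ψ all n + 1 terms of the creator contribute the same integral, their signs
squaring to one; (n + 1)/√(n + 1) = √(n + 1) is the factor of the annihilator. -/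
lemma integral_conj_zCre_mul (hd : ∀ ξ, u ξ ξ = 0) (hu : MeasurablePhase u) (hφ : MemLp φ 2 μ)
    (hχ : SqInt μ χ) (hψ : FiniteParticle σ μ ψ) (n : ℕ) :
    ∫ η, conj (zCre σ u (fun ξ => conj (φ ξ)) χ (n + 1) η) * ψ (n + 1) η ∂(nMeasure μ (n + 1)) =
      (Real.sqrt (n + 1) : ℂ) * ∫ z : X × (Fin n → X), φ z.1 * conj (χ n z.2) *
        (Complex.exp (Complex.I * ((-∑ j, u z.1 (z.2 j) : ℝ) : ℂ)) *
          ψ (n + 1) (Fin.cons z.1 z.2 : Fin (n + 1) → X)) ∂(μ.prod (nMeasure μ n)) := by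
  set T := ∫ z : X × (Fin n → X), φ z.1 * conj (χ n z.2) *
        (Complex.exp (Complex.I * ((-∑ j, u z.1 (z.2 j) : ℝ) : ℂ)) *
          ψ (n + 1) (Fin.cons z.1 z.2 : Fin (n + 1) → X)) ∂(μ.prod (nMeasure μ n)) with hT
  have hterm : ∀ k : Fin (n + 1), ∫ η : Fin (n + 1) → X, conj (σ.swapSign k * conj (φ (η k)) *
      Complex.exp (Complex.I * ((∑ j, u (η k) (η j) : ℝ) : ℂ)) *
      χ n (fun j => η (k.succAbove j))) * ψ (n + 1) η ∂(nMeasure μ (n + 1)) = T := by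
    intro k
    rw [← (measurePreserving_insertEquiv (μ := μ) k).integral_comp', hT]
    refine integral_congr_ae ?_
    filter_upwards [(measurePreserving_insertEquiv (μ := μ) 0).quasiMeasurePreserving.ae
      (hψ.symm (n + 1) k.cycleRange)] with z hz
    rw [insertEquiv_zero, ← insertNth_eq_cons_cycleRange, character_cycleRange] at hz
    have h1 : ∑ j, u z.1 ((k.insertNth z.1 z.2 : Fin (n + 1) → X) j) = ∑ j, u z.1 (z.2 j) := by
      rw [Fin.sum_univ_succAbove _ k]; simp [hd]
    simp only [insertEquiv_apply, Fin.insertNth_apply_same, Fin.insertNth_apply_succAbove, h1, hz,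
      map_mul, Complex.conj_conj, conj_swapSign, conj_exp_I_mul]
    linear_combination (φ z.1 * conj (χ n z.2) *
        (Complex.exp (Complex.I * ((-∑ j, u z.1 (z.2 j) : ℝ) : ℂ)) *
          ψ (n + 1) (Fin.cons z.1 z.2 : Fin (n + 1) → X))) * swapSign_mul_self (σ := σ) (k : ℕ)
  have hsum : ∫ η, conj (zCre σ u (fun ξ => conj (φ ξ)) χ (n + 1) η) * ψ (n + 1) η
      ∂(nMeasure μ (n + 1)) = (Real.sqrt (n + 1) : ℂ)⁻¹ * ∑ _k : Fin (n + 1), T := by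
    rw [← Finset.sum_congr rfl fun k _ => hterm k, ← integral_finsetSum, ← integral_const_mul]
    · congr 1
      funext η
      simp only [zCre, map_mul, map_sum, map_inv₀, Complex.conj_ofReal, Finset.sum_mul,
        Finset.mul_sum]
      refine Finset.sum_congr rfl fun k _ => ?_
      ring
    · exact fun k _ => (memLp_created hu hφ.star hχ k).star.integrable_mul (hψ.memLp (n + 1))
  rw [hsum]
  have hs : (Real.sqrt (n + 1) : ℂ) * (Real.sqrt (n + 1) : ℂ) = (n : ℂ) + 1 := by
    rw [← Complex.ofReal_mul, Real.mul_self_sqrt (by positivity)]; push_cast; ring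
  have h0 : (Real.sqrt (n + 1) : ℂ) ≠ 0 := by
    rw [Complex.ofReal_ne_zero]; positivity
  simp only [Finset.sum_const, Finset.card_univ, Fintype.card_fin, nsmul_eq_mul, Nat.cast_add,
    Nat.cast_one, ← hs]
  field_simp

lemma fockInner_zAnn_right (hd : ∀ ξ, u ξ ξ = 0) (hu : MeasurablePhase u) (hφ : MemLp φ 2 μ)
    (hχ : SqInt μ χ) (hψ : FiniteParticle σ μ ψ) :
    fockInner μ χ (zAnn μ u φ ψ) = fockInner μ (zCre σ u (fun ξ => conj (φ ξ)) χ) ψ := by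
  unfold fockInner
  rw [← Nat.succ_injective.tsum_eq (f := fun n => ∫ η,
    conj (zCre σ u (fun ξ => conj (φ ξ)) χ n η) * ψ n η ∂(nMeasure μ n))]
  · congr 1
    funext n
    rw [integral_conj_mul_zAnn hd hu hφ hχ hψ.memLp,
      ← integral_conj_zCre_mul hd hu hφ hχ hψ]
  · intro n hn
    cases n with
    | zero => simp [zCre] at hn
    | succ n => exact ⟨n, rfl⟩

/-- The conjugate of `∫ φ Z + ∫ φ' Z*` is `∫ conj φ' Z + ∫ conj φ Z*`. -/
lemma isHermitianConj_zAnn_add_zCre (hd : ∀ ξ, u ξ ξ = 0) (hu : MeasurablePhase u)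
    (hφ : MemLp φ 2 μ) (hφ' : MemLp φ' 2 μ) :
    IsHermitianConj σ μ (fun ψ => zAnn μ u φ ψ + zCre σ u φ' ψ)
      fun ψ => zAnn μ u (fun ξ => conj (φ' ξ)) ψ + zCre σ u (fun ξ => conj (φ ξ)) ψ := by
  intro χ ψ hχ hψ
  have h' : MemLp (fun ξ => conj (φ' ξ)) 2 μ := hφ'.star
  have h : MemLp (fun ξ => conj (φ ξ)) 2 μ := hφ.star
  -- The adjoint of the creator is read off from that of the annihilator by conjugating the inner
  -- product, which swaps the roles of χ and ψ.
  rw [fockInner_add_right hχ (SqInt.zAnn hd hu hφ hψ.memLp) (SqInt.zCre hu hφ' hψ.memLp),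
    fockInner_zAnn_right hd hu hφ hχ.memLp hψ, add_comm, ← conj_fockInner ψ (_ + _),
    fockInner_add_right hψ (SqInt.zAnn hd hu h' hχ.memLp) (SqInt.zCre hu h hχ.memLp),
    fockInner_zAnn_right hd hu h' hψ.memLp hχ, map_add, conj_fockInner, conj_fockInner]
  simp only [Complex.conj_conj]

end Hermitian

/-! ### The operators conjugated by `J` -/

section Right

variable {X : Type}

/-- Reversal of the order of the particles. -/
def reverse (ψ : Wave X) : Wave X := fun n η => ψ n fun i => η i.rev

lemma reverse_reverse (ψ : Wave X) : reverse (reverse ψ) = ψ := by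
  funext n η; simp [reverse]

lemma reverse_add (ψ χ : Wave X) : reverse (ψ + χ) = reverse ψ + reverse χ := rfl

lemma sum_rev {n : ℕ} (f : Fin n → ℝ) : ∑ j : Fin n, f j.rev = ∑ j, f j :=
  Equiv.sum_comp Fin.revPerm f

/-- The annihilator acting on the last particle, with transposed phases. -/
def zAnnRight [MeasurableSpace X] (μ : Measure X) (u : X → X → ℝ) (φ : X → ℂ) (ψ : Wave X) :
    Wave X :=
  reverse (zAnn μ (fun ξ η => u η ξ) φ (reverse ψ))

/-- The creator adding particles at the end, with transposed phases. -/
def zCreRight (σ : Statistics) (u : X → X → ℝ) (φ : X → ℂ) (ψ : Wave X) : Wave X :=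
  reverse (zCre σ (fun ξ η => u η ξ) φ (reverse ψ))

lemma zAnnRight_apply [MeasurableSpace X] {μ : Measure X} [SigmaFinite μ] {u : X → X → ℝ} {φ : X → ℂ}
    {ψ : Wave X} (hd : ∀ ξ, u ξ ξ = 0) (n : ℕ) (η : Fin n → X) :
    zAnnRight μ u φ ψ n η = (Real.sqrt (n + 1) : ℂ) * ∫ ξ, φ ξ *
      (Complex.exp (Complex.I * ((-∑ j, u (η j) ξ : ℝ) : ℂ)) *
        ψ (n + 1) (Fin.snoc η ξ : Fin (n + 1) → X)) ∂μ := by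
  rw [zAnnRight, reverse, zAnn_apply (u := fun ξ η => u η ξ) hd]
  congr 2
  funext ξ
  rw [sum_rev fun j => u (η j) ξ, reverse]
  congr 3
  funext i
  rw [Fin.cons_rev]
  congr 1
  funext j
  simp

lemma zCreRight_apply {σ : Statistics} {u : X → X → ℝ} {φ : X → ℂ}
    {ψ : Wave X} (n : ℕ) (η : Fin (n + 1) → X) :
    zCreRight σ u φ ψ (n + 1) η = (Real.sqrt (n + 1) : ℂ)⁻¹ *
      ∑ k : Fin (n + 1), σ.swapSign k.rev * φ (η k) *
        Complex.exp (Complex.I * ((∑ j, u (η j) (η k) : ℝ) : ℂ)) *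
        ψ n (fun j => η (k.succAbove j)) := by
  simp only [zCreRight, reverse, zCre]
  congr 1
  rw [← Equiv.sum_comp Fin.revPerm (fun k : Fin (n + 1) => σ.swapSign k.rev * φ (η k) *
        Complex.exp (Complex.I * ((∑ j, u (η j) (η k) : ℝ) : ℂ)) *
        ψ n (fun j => η (k.succAbove j)))]
  refine Finset.sum_congr rfl fun k _ => ?_
  rw [sum_rev fun j => u (η j) (η k.rev)]
  simp [Fin.rev_succAbove]

lemma sum_sum_succAbove {n : ℕ} (w : X → X → ℝ) (ζ : Fin (n + 1) → X) (k : Fin (n + 1)) :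
    ∑ i, ∑ j, w (ζ i) (ζ j) = w (ζ k) (ζ k) +
      ∑ j, (w (ζ k) (ζ (k.succAbove j)) + w (ζ (k.succAbove j)) (ζ k)) +
      ∑ i, ∑ j, w (ζ (k.succAbove i)) (ζ (k.succAbove j)) := by
  simp only [Fin.sum_univ_succAbove _ k, Finset.sum_add_distrib]
  ring

lemma sum_sum_rev {n : ℕ} (w : X → X → ℝ) (η : Fin n → X) :
    ∑ i, ∑ j, w (η i) (η j) = ∑ i : Fin n, ∑ j : Fin n, w (η i.rev) (η j.rev) := by
  rw [← Equiv.sum_comp Fin.revPerm]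
  refine Finset.sum_congr rfl fun i _ => ?_
  rw [← Equiv.sum_comp Fin.revPerm]
  simp

variable [MeasurableSpace X]

/-- Phases `u` of the `Z`-operators and `w` of the scattering operator that fit together, and are
invariant under the charge conjugation `c`. -/
structure CompatiblePhases (μ : Measure X) (c : X → X) (u w : X → X → ℝ) : Prop where
  involutive : Function.Involutive c
  measurePreserving : MeasurePreserving c μ μ
  diag : ∀ ξ, u ξ ξ = 0
  diag_scattering : ∀ ξ, w ξ ξ = 0
  pair : ∀ ξ η, w ξ η + w η ξ = u ξ η + u η ξ
  conj_phase : ∀ ξ η, u (c ξ) (c η) = u ξ η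
  conj_scattering : ∀ ξ η, w (c ξ) (c η) = w ξ η
  measurable_phase : MeasurablePhase u
  measurable_scattering : MeasurablePhase w

variable {μ : Measure X} [SigmaFinite μ] {c : X → X} {u w : X → X → ℝ} {σ : Statistics}

/-- Here the pair condition is used: the scattering phase of particle k with the rest splits into
the phase of a left operator and the transposed phase of a right one. -/
lemma CompatiblePhases.sum_sum (h : CompatiblePhases μ c u w) {n : ℕ} (ζ : Fin (n + 1) → X)
    (k : Fin (n + 1)) :
    ∑ i, ∑ j, w (ζ i) (ζ j) = ∑ j, u (ζ k) (ζ j) + ∑ j, u (ζ j) (ζ k) +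
      ∑ i, ∑ j, w (ζ (k.succAbove i)) (ζ (k.succAbove j)) := by
  rw [sum_sum_succAbove w ζ k, h.diag_scattering]
  simp only [h.pair, Fin.sum_univ_succAbove (fun j => u (ζ k) (ζ j)) k,
    Fin.sum_univ_succAbove (fun j => u (ζ j) (ζ k)) k, h.diag, Finset.sum_add_distrib]
  ring

lemma CompatiblePhases.measurableEmbedding (h : CompatiblePhases μ c u w) :
    MeasurableEmbedding c :=
  (MeasurableEquiv.ofInvolutive c h.involutive h.measurePreserving.measurable).measurableEmbedding

lemma CompatiblePhases.conjByJ_zAnn (h : CompatiblePhases μ c u w) (φ : X → ℂ) (ψ : Wave X) :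
    conjByJ (modularJ c w) (zAnn μ u φ) ψ = zAnnRight μ u (fun ξ => conj (φ (c ξ))) ψ := by
  funext n η
  rw [zAnnRight_apply h.diag]
  simp only [conjByJ]
  rw [modularJ, scattering, freeJ, zAnn_apply h.diag, map_mul, Complex.conj_ofReal,
    ← integral_conj, mul_left_comm, ← integral_const_mul,
    ← h.measurePreserving.integral_comp h.measurableEmbedding]
  congr 2
  funext ξ
  have hsn : (fun i : Fin (n + 1) => c ((Fin.cons (c ξ) (fun i : Fin n => c (η i.rev)) :
      Fin (n + 1) → X) i.rev)) = Fin.snoc η ξ := by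
    funext i
    rw [Fin.cons_rev]
    refine Fin.lastCases ?_ (fun j => ?_) i
    · simp [h.involutive ξ]
    · simp [h.involutive (η j)]
  have hW := h.sum_sum (Fin.cons (c ξ) (fun i : Fin n => c (η i.rev))) 0
  simp only [Fin.sum_univ_succ (fun j => u _ _), Fin.cons_zero, Fin.cons_succ, h.diag,
    Fin.zero_succAbove, h.conj_phase, h.conj_scattering, ← sum_sum_rev, zero_add] at hW
  rw [modularJ, scattering, freeJ, hsn, hW]
  simp only [map_mul, Complex.conj_conj, conj_exp_I_mul, h.conj_phase]
  rw [sum_rev fun j => u ξ (η j), sum_rev fun j => u (η j) ξ]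
  -- The outer `J` contributes the n-particle phase, the inner one minus the (n + 1)-particle phase
  -- because it is complex conjugated; only the transposed phase is left.
  have e : Complex.exp (Complex.I * ((∑ i, ∑ j, w (η i) (η j) : ℝ) : ℂ)) *
      Complex.exp (Complex.I * ((- -∑ j, u ξ (η j) : ℝ) : ℂ)) *
      Complex.exp (Complex.I * ((-(∑ j, u ξ (η j) + ∑ j, u (η j) ξ +
        ∑ i, ∑ j, w (η i) (η j)) : ℝ) : ℂ)) =
      Complex.exp (Complex.I * ((-∑ j, u (η j) ξ : ℝ) : ℂ)) := by
    rw [← Complex.exp_add, ← Complex.exp_add]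
    congr 1
    push_cast
    ring
  rw [← e]
  ring

lemma CompatiblePhases.conjByJ_zCre (h : CompatiblePhases μ c u w) (φ : X → ℂ) (ψ : Wave X) :
    conjByJ (modularJ c w) (zCre σ u φ) ψ = zCreRight σ u (fun ξ => conj (φ (c ξ))) ψ := by
  funext n η
  cases n with
  | zero => simp [conjByJ, modularJ, scattering, freeJ, zCreRight, reverse, zCre]
  | succ n =>
    simp only [conjByJ, zCreRight, reverse]
    rw [modularJ, scattering, freeJ]
    simp only [zCre, map_mul, map_sum, map_inv₀, Complex.conj_ofReal, Finset.mul_sum]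
    refine Finset.sum_congr rfl fun k _ => ?_
    have hW := h.sum_sum (fun i => η i.rev) k
    rw [modularJ, scattering, freeJ, sum_sum_rev w η, hW]
    simp only [map_mul, Complex.conj_conj, conj_exp_I_mul, h.conj_phase, h.conj_scattering,
      conj_swapSign, h.involutive _]
    have e : Complex.exp (Complex.I * ((∑ j : Fin (n + 1), u (η k.rev) (η j.rev) +
          ∑ j : Fin (n + 1), u (η j.rev) (η k.rev) + ∑ i : Fin n, ∑ j : Fin n,
            w (η (k.succAbove i).rev) (η (k.succAbove j).rev) : ℝ) : ℂ)) *
        Complex.exp (Complex.I * ((-∑ j : Fin (n + 1), u (η k.rev) (η j.rev) : ℝ) : ℂ)) *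
        Complex.exp (Complex.I * ((-∑ i : Fin n, ∑ j : Fin n,
            w (η (k.succAbove i).rev) (η (k.succAbove j).rev) : ℝ) : ℂ)) =
        Complex.exp (Complex.I * ((∑ j : Fin (n + 1), u (η j.rev) (η k.rev) : ℝ) : ℂ)) := by
      rw [← Complex.exp_add, ← Complex.exp_add]
      congr 1
      push_cast
      ring
    rw [← e]
    simp only [reverse]
    ring

end Right

/-! ### Commutators of left and right operators -/

section Commutators

variable {X : Type} [MeasurableSpace X] {μ : Measure X} [SigmaFinite μ] {u w : X → X → ℝ}
  {φ χ : X → ℂ} {ψ : Wave X} {σ : Statistics} {c : X → X}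

lemma VecEq.reverse {ψ ψ' : Wave X} (h : VecEq μ ψ ψ') : VecEq μ (reverse ψ) (reverse ψ') :=
  fun n => (measurePreserving_comp_perm Fin.revPerm).quasiMeasurePreserving.ae (h n)

lemma SqInt.reverse (hψ : SqInt μ ψ) : SqInt μ (reverse ψ) :=
  fun n => (hψ n).comp_measurePreserving (measurePreserving_comp_perm Fin.revPerm)

/-- Provides the joint integrability in the first and last particle needed to interchange two
annihilation integrals. -/
lemma ae_memLp_cons_snoc (hψ : SqInt μ ψ) (n : ℕ) :
    ∀ᵐ η ∂(nMeasure μ n), MemLp (fun z : X × X =>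
      ψ (n + 1 + 1) (Fin.cons z.1 (Fin.snoc η z.2 : Fin (n + 1) → X) : Fin (n + 1 + 1) → X)) 2
      (μ.prod μ) := by
  have h1 : MeasurePreserving (MeasurableEquiv.prodAssoc : (X × X) × (Fin n → X) ≃ᵐ _)
      ((μ.prod μ).prod (nMeasure μ n)) (μ.prod (μ.prod (nMeasure μ n))) :=
    measurePreserving_prodAssoc _ _ _
  have h2 := ((measurePreserving_insertEquiv (μ := μ) (0 : Fin (n + 1 + 1))).comp
    ((MeasurePreserving.id μ).prod
      (measurePreserving_insertEquiv (μ := μ) (Fin.last n)))).comp h1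
  have h3 := (hψ (n + 1 + 1)).comp_measurePreserving h2
  filter_upwards [MemLp.ae_slice_left h3] with η hη
  refine hη.ae_eq (.of_forall fun z => ?_)
  simp only [Function.comp, Prod.map, insertEquiv_zero, insertEquiv_last, id]
  rfl

/-- Left and right annihilators commute. -/
lemma zAnnRight_zAnn (hd : ∀ ξ, u ξ ξ = 0) (hu : MeasurablePhase u) (hφ : MemLp φ 2 μ)
    (hχ : MemLp χ 2 μ) (hψ : SqInt μ ψ) :
    VecEq μ (zAnnRight μ u φ (zAnn μ u χ ψ)) (zAnn μ u χ (zAnnRight μ u φ ψ)) := by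
  intro n
  filter_upwards [ae_memLp_cons_snoc hψ n] with η hη
  -- The mutual term u(ξ, ξ') occurs once in either order: whichever operator's integral is
  -- outermost, the other still sees the particle it removes, and the transposition puts the
  -- arguments in the same order.
  set v : X → X → ℝ := fun ξ ξ' => -(∑ j, u (η j) ξ' + (∑ j, u ξ (η j) + u ξ ξ')) with hv
  set F : X → X → ℂ := fun ξ ξ' => χ ξ * φ ξ' * (Complex.exp (Complex.I * (v ξ ξ' : ℂ)) *
    ψ (n + 1 + 1) (Fin.cons ξ (Fin.snoc η ξ' : Fin (n + 1) → X) : Fin (n + 1 + 1) → X)) with hF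
  have hm : Measurable fun z : X × X => Complex.exp (Complex.I * (v z.1 z.2 : ℂ)) :=
    measurable_exp_neg (measurable_exp_add
      (measurable_exp_sum _ fun j _ => hu.comp measurable_const measurable_snd)
      (measurable_exp_add (measurable_exp_sum _ fun j _ => hu.comp measurable_fst measurable_const)
        (hu.comp measurable_fst measurable_snd)))
  have hi : Integrable (Function.uncurry F) (μ.prod μ) :=
    (memLp_two_mul_prod hχ hφ).integrable_mul
      (MemLp.phase_mul hη (v := fun z : X × X => v z.1 z.2) hm)
  set a : ℂ := (Real.sqrt (n + 1) : ℂ)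
  set b : ℂ := (Real.sqrt ((n + 1 : ℕ) + 1) : ℂ)
  have hl : zAnnRight μ u φ (zAnn μ u χ ψ) n η = a * b * ∫ ξ', ∫ ξ, F ξ ξ' ∂μ ∂μ := by
    rw [zAnnRight_apply hd, mul_assoc, ← integral_const_mul b]
    congr 2
    funext ξ'
    rw [zAnn_apply hd, ← integral_const_mul, ← integral_const_mul, ← integral_const_mul,
      ← integral_const_mul]
    congr 1
    funext ξ
    rw [Fin.sum_univ_castSucc]
    simp only [Fin.snoc_castSucc, Fin.snoc_last, hF, hv, neg_add, Complex.ofReal_add, mul_add,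
      Complex.exp_add]
    ring
  have hr : zAnn μ u χ (zAnnRight μ u φ ψ) n η = a * b * ∫ ξ, ∫ ξ', F ξ ξ' ∂μ ∂μ := by
    rw [zAnn_apply hd, mul_assoc, ← integral_const_mul b]
    congr 2
    funext ξ
    rw [zAnnRight_apply hd, ← integral_const_mul, ← integral_const_mul, ← integral_const_mul,
      ← integral_const_mul]
    congr 1
    funext ξ'
    rw [Fin.sum_univ_succ, ← Fin.cons_snoc_eq_snoc_cons]
    simp only [Fin.cons_succ, Fin.cons_zero, hF, hv, neg_add, Complex.ofReal_add, mul_add,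
      Complex.exp_add]
    ring
  rw [hl, hr, integral_integral_swap hi]

/-- Left and right creators commute. -/
lemma zCreRight_zCre : zCreRight σ u φ (zCre σ u χ ψ) = zCre σ u χ (zCreRight σ u φ ψ) := by
  funext n η
  match n with
  | 0 => simp [zCreRight, reverse, zCre]
  | 1 => simp [zCreRight, reverse, zCre]
  | n + 1 + 1 =>
    rw [zCreRight_apply]
    simp only [zCre, zCreRight_apply]
    simp only [Finset.mul_sum]
    rw [← Fintype.sum_prod_type', ← Fintype.sum_prod_type']
    -- A pair (k, l) encodes two distinct positions taken one after the other; the involution takes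
    -- the same two positions in the opposite order.
    have inv : Function.Involutive fun z : Fin (n + 2) × Fin (n + 1) =>
        (z.1.succAbove z.2, z.2.predAbove z.1) := fun z => by
      simp [Fin.succAbove_succAbove_predAbove, Fin.predAbove_predAbove_succAbove]
    refine Fintype.sum_equiv inv.toPerm _ _ fun z => ?_
    obtain ⟨k, l⟩ := z
    simp only [Function.Involutive.coe_toPerm, Fin.succAbove_succAbove_predAbove,
      Fin.succAbove_succAbove_succAbove_predAbove]
    set k' := k.succAbove l with hk'
    set l' := l.predAbove k with hl'
    have hk : k'.succAbove l' = k := Fin.succAbove_succAbove_predAbove k l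
    -- A right creator counts the particles behind it and a left one those before it. Taking out the
    -- other particle shifts both counts by one or neither, so no relative sign arises.
    have hsign : σ.swapSign k.rev * σ.swapSign l = σ.swapSign k' * σ.swapSign l'.rev := by
      rw [← swapSign_add, ← swapSign_add]
      congr 1
      rw [hk', hl', Fin.val_rev, Fin.val_rev]
      rcases lt_or_ge l.castSucc k with h | h
      · rw [Fin.succAbove_of_castSucc_lt _ _ h, Fin.predAbove_of_castSucc_lt _ _ h]
        simp only [Fin.val_castSucc, Fin.val_pred]
        simp only [Fin.lt_def, Fin.val_castSucc] at h
        omega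
      · rw [Fin.succAbove_of_le_castSucc _ _ h, Fin.predAbove_of_le_castSucc _ _ h]
        simp only [Fin.val_succ, Fin.coe_castPred]
        simp only [Fin.le_def, Fin.val_castSucc] at h
        omega
    have hphase : Complex.exp (Complex.I * ((∑ j, u (η j) (η k) : ℝ) : ℂ)) *
        Complex.exp (Complex.I * ((∑ j, u (η k') (η (k.succAbove j)) : ℝ) : ℂ)) =
        Complex.exp (Complex.I * ((∑ j, u (η k') (η j) : ℝ) : ℂ)) *
        Complex.exp (Complex.I * ((∑ j, u (η (k'.succAbove j)) (η k) : ℝ) : ℂ)) := by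
      rw [← Complex.exp_add, ← Complex.exp_add, Fin.sum_univ_succAbove (fun j => u (η j) (η k)) k',
        Fin.sum_univ_succAbove (fun j => u (η k') (η j)) k]
      congr 1
      push_cast
      ring
    linear_combination ((Real.sqrt ((n + 1 : ℕ) + 1) : ℂ)⁻¹ * (Real.sqrt (n + 1) : ℂ)⁻¹ * φ (η k) *
      χ (η k') * ψ n fun j => η (k.succAbove (l.succAbove j))) *
      (Complex.exp (Complex.I * ((∑ j, u (η j) (η k) : ℝ) : ℂ)) *
        Complex.exp (Complex.I * ((∑ j, u (η k') (η (k.succAbove j)) : ℝ) : ℂ)) * hsign +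
      σ.swapSign k' * σ.swapSign l'.rev * hphase)

/-- Multiplication by the contraction of a left and a right operator. -/
def exchange (μ : Measure X) (σ : Statistics) (u : X → X → ℝ) (ρ : X → ℂ) (ψ : Wave X) : Wave X :=
  fun n η => σ.swapSign n *
    (∫ ξ, ρ ξ * Complex.exp (Complex.I * ((∑ j, u (η j) ξ - ∑ j, u ξ (η j) : ℝ) : ℂ)) ∂μ) * ψ n η

lemma integrable_contraction (hu : MeasurablePhase u) {ρ : X → ℂ} (hρ : Integrable ρ μ) {n : ℕ}
    (η : Fin n → X) : Integrable (fun ξ => ρ ξ *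
      Complex.exp (Complex.I * ((∑ j, u (η j) ξ - ∑ j, u ξ (η j) : ℝ) : ℂ))) μ := by
  have hm : Measurable fun ξ =>
      Complex.exp (Complex.I * ((∑ j, u (η j) ξ + -∑ j, u ξ (η j) : ℝ) : ℂ)) :=
    measurable_exp_add
      (measurable_exp_sum _ fun j _ => hu.comp measurable_const measurable_id)
      (measurable_exp_neg (measurable_exp_sum _ fun j _ => hu.comp measurable_id measurable_const))
  refine hρ.mono (hρ.1.mul hm.aestronglyMeasurable) (.of_forall fun ξ => ?_)
  rw [norm_mul, mul_comm Complex.I, Complex.norm_exp_ofReal_mul_I, mul_one]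

lemma sqrt_cast_ne_zero (n : ℕ) : (Real.sqrt (n + 1) : ℂ) ≠ 0 := by
  rw [Complex.ofReal_ne_zero]; positivity

/-- The annihilated particle is either the one just created, at the cost of passing n others, which
gives the contraction, or another one, and then the two operators can be interchanged. -/
lemma zAnn_zCreRight (hd : ∀ ξ, u ξ ξ = 0) (hu : MeasurablePhase u) (hφ : MemLp φ 2 μ)
    (hχ : MemLp χ 2 μ) (hψ : SqInt μ ψ) :
    VecEq μ (zAnn μ u χ (zCreRight σ u φ ψ))
      (zCreRight σ u φ (zAnn μ u χ ψ) + exchange μ σ u (χ * φ) ψ) := by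
  intro n
  have hA := fun η : Fin n → X => integrable_contraction hu (hχ.integrable_mul hφ) η
  cases n with
  | zero =>
    refine .of_forall fun η => ?_
    have h0 : zCreRight σ u φ (zAnn μ u χ ψ) 0 η = 0 := by simp [zCreRight, reverse, zCre]
    rw [Pi.add_apply, Pi.add_apply, h0, zero_add, zAnn_apply hd, exchange, ← integral_const_mul,
      mul_right_comm, ← integral_const_mul]
    congr 1
    funext ξ
    have h1 : (fun j => (Fin.cons ξ η : Fin 1 → X) ((0 : Fin 1).succAbove j)) = η := by
      funext j; exact j.elim0
    rw [zCreRight_apply]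
    simp only [Fin.sum_univ_succ, Fin.sum_univ_zero, Fin.cons_zero, h1, hd]
    simp
    ring
  | succ n =>
    have h1 : ∀ᵐ η ∂(nMeasure μ (n + 1)), ∀ k : Fin (n + 1), MemLp (fun ξ =>
        Complex.exp (Complex.I * ((-∑ j, u ξ (η (k.succAbove j)) : ℝ) : ℂ)) *
          ψ (n + 1) (Fin.cons ξ fun j => η (k.succAbove j) : Fin (n + 1) → X)) 2 μ :=
      ae_all_iff.2 fun k => (quasiMeasurePreserving_succAbove k).ae
        (MemLp.ae_slice_left (memLp_annihilated hu hψ n))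
    filter_upwards [h1] with η hη
    have hB := fun k => hχ.integrable_mul (hη k)
    set C : Fin (n + 1) → ℂ := fun k => σ.swapSign k.rev * φ (η k) *
      Complex.exp (Complex.I * ((∑ j, u (η j) (η k) : ℝ) : ℂ)) with hC
    set s : ℂ := (Real.sqrt ((n + 1 : ℕ) + 1) : ℂ) with hs
    have hs0 : s ≠ 0 := sqrt_cast_ne_zero (n + 1)
    have key : ∀ ξ, χ ξ * (Complex.exp (Complex.I * ((-∑ j, u ξ (η j) : ℝ) : ℂ)) *
        zCreRight σ u φ ψ (n + 1 + 1) (Fin.cons ξ η : Fin (n + 1 + 1) → X)) =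
        s⁻¹ * (σ.swapSign (n + 1) * ψ (n + 1) η * ((χ * φ) ξ *
          Complex.exp (Complex.I * ((∑ j, u (η j) ξ - ∑ j, u ξ (η j) : ℝ) : ℂ))) +
          ∑ k, C k * (χ * fun ξ =>
            Complex.exp (Complex.I * ((-∑ j, u ξ (η (k.succAbove j)) : ℝ) : ℂ)) *
            ψ (n + 1) (Fin.cons ξ fun j => η (k.succAbove j) : Fin (n + 1) → X)) ξ) := by
      intro ξ
      have hcons : ∀ ζ : X, ∑ j, u ((Fin.cons ξ η : Fin (n + 1 + 1) → X) j) ζ =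
          u ξ ζ + ∑ j, u (η j) ζ := fun ζ => by
        rw [Fin.sum_univ_succ]; simp
      rw [zCreRight_apply, ← hs, mul_left_comm _ s⁻¹, mul_left_comm _ s⁻¹]
      congr 1
      rw [Fin.sum_univ_succ (M := ℂ), mul_add, mul_add, Finset.mul_sum, Finset.mul_sum]
      congr 1
      · simp only [Fin.cons_zero, hcons, Fin.cons_succ, hd, zero_add, Fin.zero_succAbove,
          Fin.rev_zero, Fin.val_last, Pi.mul_apply, sub_eq_add_neg,
          Complex.ofReal_add, mul_add, Complex.exp_add]
        ring
      · refine Finset.sum_congr rfl fun k _ => ?_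
        have h2 : (fun j => (Fin.cons ξ η : Fin (n + 1 + 1) → X) (k.succ.succAbove j)) =
            Fin.cons ξ fun j => η (k.succAbove j) := by
          funext j
          refine Fin.cases ?_ (fun i => ?_) j <;> simp
        have h3 : Complex.exp (Complex.I * ((-∑ j, u ξ (η j) : ℝ) : ℂ)) *
            Complex.exp (Complex.I * ((∑ j : Fin (n + 1 + 1),
              u ((Fin.cons ξ η : Fin (n + 1 + 1) → X) j) (η k) : ℝ) : ℂ)) =
            Complex.exp (Complex.I * ((∑ j, u (η j) (η k) : ℝ) : ℂ)) *
            Complex.exp (Complex.I * ((-∑ j, u ξ (η (k.succAbove j)) : ℝ) : ℂ)) := by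
          rw [← Complex.exp_add, ← Complex.exp_add, hcons,
            Fin.sum_univ_succAbove (fun j => u ξ (η j)) k]
          congr 1
          push_cast
          ring
        rw [h2, Fin.cons_succ, Fin.rev_succ, Fin.val_castSucc, hC]
        simp only [Pi.mul_apply]
        linear_combination (χ ξ * σ.swapSign k.rev * φ (η k) *
          ψ (n + 1) (Fin.cons ξ fun j => η (k.succAbove j) : Fin (n + 1) → X)) * h3
    rw [zAnn_apply hd, Pi.add_apply, Pi.add_apply, zCreRight_apply, exchange, ← hs]
    simp only [key, zAnn_apply hd]
    rw [integral_const_mul, mul_inv_cancel_left₀ hs0, integral_add ((hA η).const_mul _)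
      (integrable_finsetSum _ fun k _ => (hB k).const_mul _),
      integral_finsetSum _ fun k _ => (hB k).const_mul _, add_comm]
    congr 1
    · rw [Finset.mul_sum]
      refine Finset.sum_congr rfl fun k _ => ?_
      rw [integral_const_mul]
      have := sqrt_cast_ne_zero n
      simp only [hC, Pi.mul_apply]
      field_simp
    · rw [integral_const_mul]
      ring

/-- The mirror image of `zAnn_zCreRight`: reversal exchanges left and right and transposes u, while
the contraction depends on η only through order-independent sums. -/
lemma zAnnRight_zCre (hd : ∀ ξ, u ξ ξ = 0) (hu : MeasurablePhase u) (hφ : MemLp φ 2 μ)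
    (hχ : MemLp χ 2 μ) (hψ : SqInt μ ψ) :
    VecEq μ (zAnnRight μ u φ (zCre σ u χ ψ))
      (zCre σ u χ (zAnnRight μ u φ ψ) + exchange μ σ (fun ξ η => u η ξ) (φ * χ) ψ) := by
  have h := (zAnn_zCreRight (σ := σ) (u := fun ξ η => u η ξ) hd hu.swap hχ hφ hψ.reverse).reverse
  have he : exchange μ σ (fun ξ η => u η ξ) (φ * χ) ψ =
      reverse (exchange μ σ (fun ξ η => u η ξ) (φ * χ) (reverse ψ)) := by
    funext n η
    simp only [exchange, reverse, Fin.rev_rev]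
    have h1 : ∀ ξ, ∑ j : Fin n, u (η j.rev) ξ = ∑ j, u (η j) ξ := fun ξ => sum_rev fun j => u (η j) ξ
    have h2 : ∀ ξ, ∑ j : Fin n, u ξ (η j.rev) = ∑ j, u ξ (η j) := fun ξ => sum_rev fun j => u ξ (η j)
    simp only [h1, h2]
  rw [he]
  simpa only [zCreRight, zAnnRight, reverse_add, reverse_reverse] using h

lemma SqInt.zAnnRight (hd : ∀ ξ, u ξ ξ = 0) (hu : MeasurablePhase u) (hφ : MemLp φ 2 μ)
    (hψ : SqInt μ ψ) : SqInt μ (zAnnRight μ u φ ψ) :=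
  (SqInt.zAnn (u := fun ξ η => u η ξ) hd hu.swap hφ hψ.reverse).reverse

lemma SqInt.zCreRight (hu : MeasurablePhase u) (hφ : MemLp φ 2 μ) (hψ : SqInt μ ψ) :
    SqInt μ (zCreRight σ u φ ψ) :=
  (SqInt.zCre hu.swap hφ hψ.reverse).reverse

lemma zAnnRight_add {ψ₁ ψ₂ : Wave X} (hd : ∀ ξ, u ξ ξ = 0) (hu : MeasurablePhase u)
    (hφ : MemLp φ 2 μ) (h₁ : SqInt μ ψ₁) (h₂ : SqInt μ ψ₂) :
    VecEq μ (FWG.zAnnRight μ u φ (ψ₁ + ψ₂))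
      (FWG.zAnnRight μ u φ ψ₁ + FWG.zAnnRight μ u φ ψ₂) :=
  (zAnn_add (u := fun ξ η => u η ξ) hd hu.swap hφ h₁.reverse h₂.reverse).reverse

lemma zCreRight_add {ψ₁ ψ₂ : Wave X} :
    zCreRight σ u φ (ψ₁ + ψ₂) = zCreRight σ u φ ψ₁ + zCreRight σ u φ ψ₂ := by
  simp only [zCreRight, reverse_add, zCre_add]

/-- A field and the `J`-transform of another one commute if their contractions agree. -/
theorem CompatiblePhases.commuteOnFinite (h : CompatiblePhases μ c u w) {φ' χ' : X → ℂ}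
    (hφ : MemLp φ 2 μ) (hφ' : MemLp φ' 2 μ) (hχ : MemLp χ 2 μ) (hχ' : MemLp χ' 2 μ)
    (hK : ∀ (n : ℕ) (η : Fin n → X),
      ∫ ξ, conj (φ (c ξ)) * χ' ξ *
        Complex.exp (Complex.I * ((∑ j, u ξ (η j) - ∑ j, u (η j) ξ : ℝ) : ℂ)) ∂μ =
      ∫ ξ, χ ξ * conj (φ' (c ξ)) *
        Complex.exp (Complex.I * ((∑ j, u (η j) ξ - ∑ j, u ξ (η j) : ℝ) : ℂ)) ∂μ) :
    CommuteOnFinite σ μ (conjByJ (modularJ c w) fun ψ => zAnn μ u φ ψ + zCre σ u φ' ψ)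
      fun ψ => zAnn μ u χ ψ + zCre σ u χ' ψ := by
  have hd := h.diag
  have hu := h.measurable_phase
  have hJ : ∀ ψ, conjByJ (modularJ c w) (fun ψ => zAnn μ u φ ψ + zCre σ u φ' ψ) ψ =
      zAnnRight μ u (fun ξ => conj (φ (c ξ))) ψ + zCreRight σ u (fun ξ => conj (φ' (c ξ))) ψ := by
    intro ψ
    rw [← h.conjByJ_zAnn, ← h.conjByJ_zCre]
    exact modularJ_add c w
  have hcφ : MemLp (fun ξ => conj (φ (c ξ))) 2 μ :=
    (hφ.comp_measurePreserving h.measurePreserving).star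
  have hcφ' : MemLp (fun ξ => conj (φ' (c ξ))) 2 μ :=
    (hφ'.comp_measurePreserving h.measurePreserving).star
  intro ψ hfin n
  have hψ : SqInt μ ψ := hfin.memLp
  simp only [hJ]
  filter_upwards [zAnnRight_add hd hu hcφ (hψ.zAnn hd hu hχ) (SqInt.zCre (σ := σ) hu hχ' hψ) n,
    zAnn_add hd hu hχ (hψ.zAnnRight hd hu hcφ) (SqInt.zCreRight (σ := σ) hu hcφ' hψ) n,
    zAnnRight_zAnn hd hu hcφ hχ hψ n, zAnnRight_zCre (σ := σ) hd hu hcφ hχ' hψ n,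
    zAnn_zCreRight (σ := σ) hd hu hcφ' hχ hψ n] with η e1 e2 e3 e4 e5
  simp only [Pi.add_apply] at e1 e2 e4 e5
  simp only [Pi.add_apply, e1, e2, e3, e4, e5, zCreRight_add, zCre_add, zCreRight_zCre, exchange,
    Pi.mul_apply, hK]
  ring

end Commutators

/-! ### Wave functions of test functions -/

section WaveFunctions

/-- `exp (-i p(ζ) x)` -/
def planeWave (m : ℝ) (ζ : ℂ) (x : ℝ × ℝ) : ℂ :=
  Complex.exp (-Complex.I * (m * (Complex.cosh ζ * (x.1 : ℂ) + Complex.sinh ζ * (x.2 : ℂ))))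

lemma waveFn_eq (m : ℝ) (f : ℝ × ℝ → ℂ) (ζ : ℂ) :
    waveFn m f ζ = ((Real.sqrt (2 * Real.pi))⁻¹ : ℂ) * ∫ x, planeWave m ζ x * f x := rfl

lemma norm_planeWave (m : ℝ) (ζ : ℂ) (x : ℝ × ℝ) : ‖planeWave m ζ x‖ =
    Real.exp (m * Real.sin ζ.im * (Real.sinh ζ.re * x.1 + Real.cosh ζ.re * x.2)) := by
  rw [planeWave, Complex.norm_exp]
  congr 1
  have h1 : Complex.cosh ζ = (Real.cosh ζ.re * Real.cos ζ.im : ℝ) +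
      (Real.sinh ζ.re * Real.sin ζ.im : ℝ) * Complex.I := by
    conv_lhs => rw [← Complex.re_add_im ζ, Complex.cosh_add, Complex.cosh_mul_I,
      Complex.sinh_mul_I]
    push_cast; ring
  have h2 : Complex.sinh ζ = (Real.sinh ζ.re * Real.cos ζ.im : ℝ) +
      (Real.cosh ζ.re * Real.sin ζ.im : ℝ) * Complex.I := by
    conv_lhs => rw [← Complex.re_add_im ζ, Complex.sinh_add, Complex.cosh_mul_I,
      Complex.sinh_mul_I]
    push_cast; ring
  rw [h1, h2]
  simp only [neg_mul, Complex.neg_re, Complex.I_mul_re, Complex.im_ofReal_mul, Complex.add_im,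
    Complex.mul_I_im, Complex.ofReal_re, Complex.ofReal_im,
    Complex.im_mul_ofReal]
  ring

lemma continuous_planeWave (m : ℝ) (ζ : ℂ) : Continuous (planeWave m ζ) := by
  unfold planeWave; fun_prop

/-- The rapidities for which the plane waves are bounded by one on the support of `f`. -/
def admissible (m : ℝ) (f : ℝ × ℝ → ℂ) : Set ℂ :=
  {ζ | ∀ x ∈ tsupport f, ‖planeWave m ζ x‖ ≤ 1}

lemma mem_admissible_of_sin {m : ℝ} {f : ℝ × ℝ → ℂ} {ζ : ℂ} (h : Real.sin ζ.im = 0) :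
    ζ ∈ admissible m f := fun x _ => by
  rw [norm_planeWave, h]; simp

lemma ofReal_mem_admissible (m : ℝ) (f : ℝ × ℝ → ℂ) (θ : ℝ) : (θ : ℂ) ∈ admissible m f :=
  mem_admissible_of_sin (by simp)

lemma sub_pi_mem_admissible (m : ℝ) (f : ℝ × ℝ → ℂ) (θ : ℝ) :
    (θ - Real.pi * Complex.I : ℂ) ∈ admissible m f :=
  mem_admissible_of_sin (by simp)

/-- In the closed wedge x¹ cosh dominates |x⁰ sinh|, and sin(Im ζ) ≤ 0 on this strip, so the
exponent in `norm_planeWave` is nonpositive. -/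
lemma strip_subset_admissible {m : ℝ} (hm : 0 < m) {f : ℝ × ℝ → ℂ}
    (hf : Function.support f ⊆ wedge) : {ζ : ℂ | -Real.pi ≤ ζ.im ∧ ζ.im ≤ 0} ⊆ admissible m f := by
  intro ζ hζ x hx
  have hcl : IsClosed {x : ℝ × ℝ | |x.1| ≤ x.2} := isClosed_le (by fun_prop) (by fun_prop)
  have hx' : |x.1| ≤ x.2 :=
    closure_minimal (fun y hy => (show |y.1| < y.2 from hf hy).le) hcl hx
  rw [norm_planeWave, Real.exp_le_one_iff]
  refine mul_nonpos_of_nonpos_of_nonneg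
    (mul_nonpos_of_nonneg_of_nonpos hm.le (Real.sin_nonpos_of_nonpos_of_neg_pi_le hζ.2 hζ.1)) ?_
  have h1 : |Real.sinh ζ.re| ≤ Real.cosh ζ.re := by
    rw [abs_le]
    have h1 := Real.cosh_add_sinh ζ.re
    have h2 := Real.cosh_sub_sinh ζ.re
    constructor <;> nlinarith [Real.exp_pos ζ.re, Real.exp_pos (-ζ.re)]
  have h2 : |Real.sinh ζ.re * x.1| ≤ Real.cosh ζ.re * x.2 := by
    rw [abs_mul]; exact mul_le_mul h1 hx' (abs_nonneg _) (Real.cosh_pos _).le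
  linarith [neg_abs_le (Real.sinh ζ.re * x.1)]

lemma norm_planeWave_mul_le {m : ℝ} {f g : ℝ × ℝ → ℂ} {ζ : ℂ} (hζ : ζ ∈ admissible m f)
    (hg : Function.support g ⊆ tsupport f) (x : ℝ × ℝ) : ‖planeWave m ζ x * g x‖ ≤ ‖g x‖ := by
  by_cases hx : g x = 0
  · simp [hx]
  · rw [norm_mul]
    exact mul_le_of_le_one_left (norm_nonneg _) (hζ x (hg hx))

lemma integrable_planeWave_mul {m : ℝ} {f : ℝ × ℝ → ℂ} (g : 𝓢(ℝ × ℝ, ℂ)) {ζ : ℂ}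
    (hζ : ζ ∈ admissible m f) (hg : Function.support g ⊆ tsupport f) :
    Integrable fun x => planeWave m ζ x * g x :=
  g.integrable.mono ((continuous_planeWave m ζ).mul g.continuous).aestronglyMeasurable
    (.of_forall (norm_planeWave_mul_le hζ hg))

lemma continuousOn_waveFn (m : ℝ) (f : 𝓢(ℝ × ℝ, ℂ)) :
    ContinuousOn (waveFn m f) (admissible m f) := by
  refine ContinuousOn.mul continuousOn_const ?_
  refine continuousOn_of_dominated (F := fun ζ x => planeWave m ζ x * f x)
    (fun ζ _ => ((continuous_planeWave m ζ).mul f.continuous).aestronglyMeasurable)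
    (fun ζ hζ => .of_forall (norm_planeWave_mul_le hζ subset_closure)) f.integrable.norm
    (.of_forall fun x => ?_)
  unfold planeWave
  fun_prop

lemma hasLineDerivAt_planeWave (m : ℝ) (ζ : ℂ) (x : ℝ × ℝ) (ε : ℝ) :
    HasLineDerivAt ℝ (planeWave m ζ)
      (-Complex.I * (m * (Complex.cosh ζ + ε * Complex.sinh ζ)) * planeWave m ζ x) x (1, ε) := by
  unfold HasLineDerivAt planeWave
  have h : HasDerivAt (fun t : ℝ => (t : ℂ)) 1 0 := Complex.ofRealCLM.hasDerivAt
  have h2 : HasDerivAt (fun t : ℝ => -Complex.I * (m * (Complex.cosh ζ * ((x.1 + t * 1 : ℝ) : ℂ) +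
      Complex.sinh ζ * ((x.2 + t * ε : ℝ) : ℂ))))
      (-Complex.I * (m * (Complex.cosh ζ * (1 * 1) + Complex.sinh ζ * (1 * ε)))) 0 := by
    push_cast
    exact ((((h.mul_const _).const_add _).const_mul _).add
      (((h.mul_const _).const_add _).const_mul _)).const_mul _ |>.const_mul _
  refine h2.cexp.congr_deriv ?_
  simp only [zero_mul, add_zero]
  ring

/-- Integration by parts along (1, ε). The derivative of f is still supported in `tsupport f`, where
the plane wave is bounded by one. In the lightlike directions ε = ±1 the prefactor is m·exp(±ζ), the
source of the exponential decay. -/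
lemma norm_waveFn_mul_le (m : ℝ) (f : 𝓢(ℝ × ℝ, ℂ)) {ζ : ℂ} (hζ : ζ ∈ admissible m f) (ε : ℝ) :
    ‖(m * (Complex.cosh ζ + ε * Complex.sinh ζ) : ℂ)‖ * ‖waveFn m f ζ‖ ≤
      (Real.sqrt (2 * Real.pi))⁻¹ * ∫ x, ‖LineDeriv.lineDerivOp ((1, ε) : ℝ × ℝ) f x‖ := by
  set f' := LineDeriv.lineDerivOp ((1, ε) : ℝ × ℝ) f with hf'
  have hsupp : Function.support f' ⊆ tsupport f :=
    subset_closure.trans (SchwartzMap.tsupport_lineDerivOp_subset _ f)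
  have h1 := integrable_planeWave_mul f hζ subset_closure
  have h2 := integrable_planeWave_mul f' hζ hsupp
  have h := integral_bilinear_hasLineDerivAt_right_eq_neg_left_of_integrable (μ := volume)
    (B := ContinuousLinearMap.mul ℝ ℂ) (f := planeWave m ζ) (g := f) (g' := f') (v := (1, ε))
    (f' := fun x => -Complex.I * (m * (Complex.cosh ζ + ε * Complex.sinh ζ)) * planeWave m ζ x)
    (by
      refine (h1.const_mul (-Complex.I * (m * (Complex.cosh ζ + ε * Complex.sinh ζ)))).congr
        (.of_forall fun x => ?_)
      simp [mul_assoc])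
    h2 h1 (fun x _ => hasLineDerivAt_planeWave m ζ x ε)
    (fun x _ => by
      have := (f.hasFDerivAt x).hasLineDerivAt (1, ε)
      rwa [← SchwartzMap.lineDerivOp_apply_eq_fderiv] at this)
  simp only [ContinuousLinearMap.mul_apply', mul_assoc] at h
  rw [integral_const_mul, integral_const_mul, integral_const_mul] at h
  have h3 : ‖(m * (Complex.cosh ζ + ε * Complex.sinh ζ) : ℂ)‖ *
      ‖∫ x, planeWave m ζ x * f x‖ ≤ ∫ x, ‖f' x‖ := by
    have : ‖∫ x, planeWave m ζ x * f' x‖ ≤ ∫ x, ‖f' x‖ :=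
      norm_integral_le_of_norm_le f'.integrable.norm
        (.of_forall (norm_planeWave_mul_le hζ hsupp))
    rw [h] at this
    simpa [mul_assoc] using this
  have h4 : ‖waveFn m f ζ‖ =
      (Real.sqrt (2 * Real.pi))⁻¹ * ‖∫ x, planeWave m ζ x * f x‖ := by
    rw [waveFn_eq, norm_mul, norm_inv, Complex.norm_real, Real.norm_of_nonneg (Real.sqrt_nonneg _)]
  rw [h4, mul_left_comm]
  exact mul_le_mul_of_nonneg_left h3 (by positivity)

/-- Exponential decay of the wave functions, uniformly over the admissible rapidities. -/
lemma exists_norm_waveFn_le {m : ℝ} (hm : 0 < m) (f : 𝓢(ℝ × ℝ, ℂ)) :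
    ∃ C : ℝ, 0 ≤ C ∧ ∀ ζ ∈ admissible m f, ‖waveFn m f ζ‖ ≤ C * Real.exp (-|ζ.re|) := by
  set K : ℝ → ℝ := fun ε =>
    (Real.sqrt (2 * Real.pi))⁻¹ * ∫ x, ‖LineDeriv.lineDerivOp ((1, ε) : ℝ × ℝ) f x‖ with hK
  have hK0 : ∀ ε, 0 ≤ K ε := fun ε =>
    mul_nonneg (by positivity) (integral_nonneg fun _ => norm_nonneg _)
  refine ⟨(K 1 + K (-1)) / m, div_nonneg (add_nonneg (hK0 _) (hK0 _)) hm.le, fun ζ hζ => ?_⟩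
  have h1 := norm_waveFn_mul_le m f hζ 1
  have h2 := norm_waveFn_mul_le m f hζ (-1)
  have e1 : Complex.cosh ζ + ((1 : ℝ) : ℂ) * Complex.sinh ζ = Complex.exp ζ := by
    rw [← Complex.cosh_add_sinh]; simp
  have e2 : Complex.cosh ζ + ((-1 : ℝ) : ℂ) * Complex.sinh ζ = Complex.exp (-ζ) := by
    rw [← Complex.cosh_sub_sinh]; simp [sub_eq_add_neg]
  rw [e1, norm_mul, Complex.norm_exp, Complex.norm_real, Real.norm_of_nonneg hm.le] at h1
  rw [e2, norm_mul, Complex.norm_exp, Complex.norm_real, Real.norm_of_nonneg hm.le,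
    Complex.neg_re] at h2
  have h3 : m * Real.exp |ζ.re| * ‖waveFn m f ζ‖ ≤ K 1 + K (-1) := by
    rcases abs_cases ζ.re with ⟨h, _⟩ | ⟨h, _⟩ <;> rw [h]
    · linarith [hK0 (-1)]
    · linarith [hK0 1]
  rw [Real.exp_neg, div_mul_eq_mul_div, le_div_iff₀ hm, ← div_eq_mul_inv,
    le_div_iff₀ (Real.exp_pos _)]
  linarith

lemma exp_neg_abs_sq_le (t : ℝ) : Real.exp (-|t|) ^ 2 ≤ (1 + t ^ 2)⁻¹ := by
  rw [Real.exp_neg, inv_pow]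
  refine inv_anti₀ (by positivity) ?_
  have h := Real.add_one_le_exp |t|
  have := pow_le_pow_left₀ (by positivity) h 2
  nlinarith [sq_abs t, abs_nonneg t]

lemma memLp_waveFn_comp {m : ℝ} (hm : 0 < m) (f : 𝓢(ℝ × ℝ, ℂ)) {a : ℝ → ℂ} (ha : Continuous a)
    (hre : ∀ θ, (a θ).re = θ) (hadm : ∀ θ, a θ ∈ admissible m f) :
    MemLp (fun θ => waveFn m f (a θ)) 2 := by
  obtain ⟨C, hC, h⟩ := exists_norm_waveFn_le hm f
  have hc : Continuous fun θ => waveFn m f (a θ) :=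
    (continuousOn_waveFn m f).comp_continuous ha hadm
  rw [memLp_two_iff_integrable_sq_norm hc.aestronglyMeasurable]
  refine (integrable_inv_one_add_sq.const_mul (C ^ 2)).mono'
    (hc.norm.pow 2).aestronglyMeasurable (.of_forall fun θ => ?_)
  rw [Real.norm_of_nonneg (by positivity)]
  have h1 := pow_le_pow_left₀ (norm_nonneg _) (h _ (hadm θ)) 2
  rw [hre, mul_pow] at h1
  exact h1.trans (mul_le_mul_of_nonneg_left (exp_neg_abs_sq_le θ) (by positivity))

lemma memLp_waveFn {m : ℝ} (hm : 0 < m) (f : 𝓢(ℝ × ℝ, ℂ)) :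
    MemLp (fun θ : ℝ => waveFn m f θ) 2 :=
  memLp_waveFn_comp hm f Complex.continuous_ofReal (fun _ => Complex.ofReal_re _)
    (ofReal_mem_admissible m f)

lemma memLp_waveFn_sub_pi {m : ℝ} (hm : 0 < m) (f : 𝓢(ℝ × ℝ, ℂ)) :
    MemLp (fun θ : ℝ => waveFn m f (θ - Real.pi * Complex.I)) 2 :=
  memLp_waveFn_comp hm f (by fun_prop) (fun θ => by simp) (sub_pi_mem_admissible m f)

/-- Complex conjugation of wave functions. -/
lemma waveFn_conj (m : ℝ) (f : ℝ × ℝ → ℂ) (ζ : ℂ) :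
    waveFn m (fun x => conj (f x)) (ζ - Real.pi * Complex.I) = conj (waveFn m f (conj ζ)) := by
  rw [waveFn_eq, waveFn_eq, map_mul, ← integral_conj, map_inv₀, Complex.conj_ofReal]
  congr 2
  funext x
  rw [map_mul]
  congr 1
  rw [planeWave, planeWave, ← Complex.exp_conj, Complex.cosh_sub, Complex.sinh_sub,
    Complex.cosh_mul_I, Complex.sinh_mul_I, ← Complex.ofReal_cos, ← Complex.ofReal_sin]
  simp [← Complex.cosh_conj, ← Complex.sinh_conj]
  congr 1
  ring

lemma waveFn_conj_apply (m : ℝ) (f : ℝ × ℝ → ℂ) (ζ : ℂ) :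
    waveFn m (fun x => conj (f x)) ζ = conj (waveFn m f (conj ζ - Real.pi * Complex.I)) := by
  have h := waveFn_conj m (fun x => conj (f x)) (conj ζ)
  simp only [Complex.conj_conj] at h
  rw [h, Complex.conj_conj]

lemma differentiableOn_waveFn {m : ℝ} (hm : 0 < m) (f : 𝓢(ℝ × ℝ, ℂ))
    (hf : Function.support f ⊆ wedge) :
    DifferentiableOn ℂ (waveFn m f) {ζ | -Real.pi < ζ.im ∧ ζ.im < 0} := by
  intro ζ₀ hζ₀
  refine DifferentiableAt.differentiableWithinAt (DifferentiableAt.const_mul ?_ _)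
  have hopen : IsOpen {ζ : ℂ | -Real.pi < ζ.im ∧ ζ.im < 0} :=
    (isOpen_lt continuous_const Complex.continuous_im).inter
      (isOpen_lt Complex.continuous_im continuous_const)
  -- The strip bounds the plane wave and the ball bounds cosh and sinh; the remaining factor, linear
  -- in x, is absorbed by the Schwartz function.
  have hnhds := Filter.inter_mem (hopen.mem_nhds hζ₀) (Metric.closedBall_mem_nhds ζ₀ one_pos)
  obtain ⟨M, hM⟩ := (isCompact_closedBall ζ₀ (1 : ℝ)).exists_bound_of_continuousOn
    (f := fun ζ => (Complex.sinh ζ, Complex.cosh ζ)) (by fun_prop)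
  have hadm : ∀ ζ ∈ {ζ : ℂ | -Real.pi < ζ.im ∧ ζ.im < 0}, ζ ∈ admissible m f :=
    fun ζ hζ => strip_subset_admissible hm hf ⟨hζ.1.le, hζ.2.le⟩
  refine (hasDerivAt_integral_of_dominated_loc_of_deriv_le
    (F := fun ζ x => planeWave m ζ x * f x)
    (F' := fun ζ x => planeWave m ζ x * (-Complex.I * (m * (Complex.sinh ζ * (x.1 : ℂ) +
      Complex.cosh ζ * (x.2 : ℂ)))) * f x)
    (bound := fun x => m * (M + M) * (‖x‖ ^ 1 * ‖f x‖)) hnhds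
    (.of_forall fun ζ => ((continuous_planeWave m ζ).mul f.continuous).aestronglyMeasurable)
    (integrable_planeWave_mul f (hadm _ hζ₀) subset_closure) ?_ (.of_forall fun x ζ hζ => ?_)
    ((f.integrable_pow_mul volume 1).const_mul _)
    (.of_forall fun x ζ _ => ?_)).2.differentiableAt
  · refine Continuous.aestronglyMeasurable (((continuous_planeWave m ζ₀).mul ?_).mul f.continuous)
    fun_prop
  · have h1 := norm_planeWave_mul_le (hadm ζ hζ.1) subset_closure x
    have h2 := hM ζ hζ.2
    have hs : ‖Complex.sinh ζ‖ ≤ M := (norm_fst_le _).trans h2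
    have hc : ‖Complex.cosh ζ‖ ≤ M := (norm_snd_le _).trans h2
    have hM0 : 0 ≤ M := (norm_nonneg _).trans hs
    rw [mul_right_comm, norm_mul]
    have h3 : ‖-Complex.I * (m * (Complex.sinh ζ * (x.1 : ℂ) + Complex.cosh ζ * (x.2 : ℂ)))‖ ≤
        m * (M + M) * ‖x‖ := by
      rw [norm_mul, norm_neg, Complex.norm_I, one_mul, norm_mul, Complex.norm_real,
        Real.norm_of_nonneg hm.le, mul_assoc]
      refine mul_le_mul_of_nonneg_left ?_ hm.le
      refine (norm_add_le _ _).trans ?_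
      rw [norm_mul, norm_mul, Complex.norm_real, Complex.norm_real, add_mul]
      exact add_le_add (mul_le_mul hs (norm_fst_le x) (norm_nonneg _) hM0)
        (mul_le_mul hc (norm_snd_le x) (norm_nonneg _) hM0)
    calc _ ≤ ‖f x‖ * (m * (M + M) * ‖x‖) := mul_le_mul h1 h3 (norm_nonneg _) (norm_nonneg _)
      _ = _ := by ring
  · refine HasDerivAt.mul_const ?_ _
    unfold planeWave
    exact (((((Complex.hasDerivAt_cosh ζ).mul_const _).add
      ((Complex.hasDerivAt_sinh ζ).mul_const _)).const_mul _).const_mul _).cexp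

end WaveFunctions

/-! ### Shifting the contour -/

section Contour

/-- Cauchy's theorem on the rectangles with |Re ζ| ≤ R. The same quadratic decay makes the
horizontal integrals converge and the vertical sides vanish. -/
lemma integral_eq_integral_add_pi {F : ℂ → ℂ} {C : ℝ}
    (hc : ContinuousOn F {ζ | 0 ≤ ζ.im ∧ ζ.im ≤ Real.pi})
    (hd : DifferentiableOn ℂ F {ζ | 0 < ζ.im ∧ ζ.im < Real.pi})
    (hb : ∀ ζ : ℂ, 0 ≤ ζ.im → ζ.im ≤ Real.pi → ‖F ζ‖ ≤ C * (1 + ζ.re ^ 2)⁻¹) :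
    ∫ θ : ℝ, F θ = ∫ θ : ℝ, F (θ + Real.pi * Complex.I) := by
  have hπ := Real.pi_pos
  have hint : ∀ t : ℝ, 0 ≤ t → t ≤ Real.pi → Integrable fun θ : ℝ => F (θ + t * Complex.I) := by
    intro t h0 h1
    have hcont : Continuous fun θ : ℝ => F (θ + t * Complex.I) :=
      hc.comp_continuous (by fun_prop) fun θ => by simp [h0, h1]
    refine (integrable_inv_one_add_sq.const_mul C).mono' hcont.aestronglyMeasurable
      (.of_forall fun θ => ?_)
    simpa using hb (θ + t * Complex.I) (by simpa using h0) (by simpa using h1)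
  have hside : ∀ R : ℝ, ‖∫ y in (0 : ℝ)..Real.pi, F (R + y * Complex.I)‖ ≤
      C * (1 + R ^ 2)⁻¹ * Real.pi := by
    intro R
    have := intervalIntegral.norm_integral_le_of_norm_le_const (a := 0) (b := Real.pi)
      (f := fun y : ℝ => F (R + y * Complex.I)) (C := C * (1 + R ^ 2)⁻¹) (fun y hy => by
        rw [Set.uIoc_of_le hπ.le] at hy
        simpa using hb (R + y * Complex.I) (by simpa using hy.1.le) (by simpa using hy.2))
    rwa [sub_zero, abs_of_pos hπ] at this
  have hlim0 : Filter.Tendsto (fun R : ℝ => C * (1 + R ^ 2)⁻¹ * Real.pi) Filter.atTop (nhds 0) := by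
    have h1 : Filter.Tendsto (fun R : ℝ => (1 + R ^ 2)⁻¹) Filter.atTop (nhds 0) :=
      (Filter.tendsto_atTop_add_const_left _ _ (Filter.tendsto_pow_atTop two_ne_zero)).inv_tendsto_atTop
    simpa using (h1.const_mul C).mul_const Real.pi
  have hR : Filter.Tendsto (fun R : ℝ => ∫ y in (0 : ℝ)..Real.pi, F (R + y * Complex.I))
      Filter.atTop (nhds 0) := squeeze_zero_norm hside hlim0
  have hL : Filter.Tendsto (fun R : ℝ => ∫ y in (0 : ℝ)..Real.pi, F ((-R : ℝ) + y * Complex.I))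
      Filter.atTop (nhds 0) :=
    squeeze_zero_norm (fun R => by simpa using hside (-R)) hlim0
  have hB := intervalIntegral_tendsto_integral (hint 0 le_rfl hπ.le) Filter.tendsto_neg_atTop_atBot
    Filter.tendsto_id
  have hT := intervalIntegral_tendsto_integral (hint Real.pi hπ.le le_rfl)
    Filter.tendsto_neg_atTop_atBot Filter.tendsto_id
  have hrect : ∀ R : ℝ, (∫ θ in -R..R, F (θ + (0 : ℝ) * Complex.I)) -
      (∫ θ in -R..R, F (θ + Real.pi * Complex.I)) +
      Complex.I * (∫ y in (0 : ℝ)..Real.pi, F (R + y * Complex.I)) -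
      Complex.I * (∫ y in (0 : ℝ)..Real.pi, F ((-R : ℝ) + y * Complex.I)) = 0 := by
    intro R
    have h := Complex.integral_boundary_rect_eq_zero_of_continuousOn_of_differentiableOn F
      (-R : ℝ) (R + Real.pi * Complex.I)
      (hc.mono fun ζ hζ => by
        have := hζ.2
        simpa [Set.uIcc_of_le hπ.le] using this)
      (hd.mono fun ζ hζ => by
        have := hζ.2
        simpa [hπ.le] using this)
    simpa using h
  have hlim := ((hB.sub hT).add (hR.const_mul Complex.I)).sub (hL.const_mul Complex.I)
  simp only [id, hrect, mul_zero, add_zero, sub_zero] at hlim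
  have := tendsto_nhds_unique hlim tendsto_const_nhds
  simpa [sub_eq_zero] using this

/-- Crossing of wave functions localized in the wedge. -/
lemma integral_waveFn_crossing {m : ℝ} (hm : 0 < m) {f g : 𝓢(ℝ × ℝ, ℂ)}
    (hf : Function.support f ⊆ wedge) (hg : Function.support g ⊆ wedge) {H : ℂ → ℂ} {B : ℝ}
    (hc : ContinuousOn H {ζ | 0 ≤ ζ.im ∧ ζ.im ≤ Real.pi})
    (hd : DifferentiableOn ℂ H {ζ | 0 < ζ.im ∧ ζ.im < Real.pi})
    (hb : ∀ ζ : ℂ, 0 ≤ ζ.im → ζ.im ≤ Real.pi → ‖H ζ‖ ≤ B) :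
    ∫ θ : ℝ, conj (waveFn m f θ) * waveFn m g (θ - Real.pi * Complex.I) * H θ =
      ∫ θ : ℝ, waveFn m g θ * conj (waveFn m f (θ - Real.pi * Complex.I)) *
        H (θ + Real.pi * Complex.I) := by
  obtain ⟨Cf, hCf, hCf'⟩ := exists_norm_waveFn_le hm f
  obtain ⟨Cg, hCg, hCg'⟩ := exists_norm_waveFn_le hm g
  have hB : 0 ≤ B := (norm_nonneg _).trans (hb 0 (by simp) (by simpa using Real.pi_pos.le))
  have h1 : ∀ ζ : ℂ, 0 ≤ ζ.im ∧ ζ.im ≤ Real.pi → conj ζ ∈ admissible m f := fun ζ hζ =>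
    strip_subset_admissible hm hf (by simpa using hζ.symm)
  have h2 : ∀ ζ : ℂ, 0 ≤ ζ.im ∧ ζ.im ≤ Real.pi → ζ - Real.pi * Complex.I ∈ admissible m g :=
    fun ζ hζ => strip_subset_admissible hm hg (by simpa using hζ)
  -- Conjugating both argument and value keeps the first factor holomorphic and reflects its strip
  -- onto 0 ≤ Im ζ ≤ π, where the second factor, shifted by -iπ, also lives.
  have key := integral_eq_integral_add_pi (C := Cf * Cg * B)
    (F := fun ζ => conj (waveFn m f (conj ζ)) * waveFn m g (ζ - Real.pi * Complex.I) * H ζ)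
    ?_ ?_ ?_
  · simpa [mul_comm, mul_left_comm, mul_assoc, sub_eq_add_neg] using key
  · refine (ContinuousOn.mul ?_ ?_).mul hc
    · exact Complex.continuous_conj.comp_continuousOn
        ((continuousOn_waveFn m f).comp Complex.continuous_conj.continuousOn h1)
    · exact (continuousOn_waveFn m g).comp (by fun_prop) h2
  · have hopen : IsOpen {ζ : ℂ | -Real.pi < ζ.im ∧ ζ.im < 0} :=
      (isOpen_lt continuous_const Complex.continuous_im).inter
        (isOpen_lt Complex.continuous_im continuous_const)
    refine (DifferentiableOn.mul ?_ ?_).mul hd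
    · intro ζ hζ
      have := (differentiableOn_waveFn hm f hf).differentiableAt
        (hopen.mem_nhds (show conj ζ ∈ _ by simpa using hζ.symm))
      have := this.conj_conj
      rw [Complex.conj_conj] at this
      exact this.differentiableWithinAt
    · exact (differentiableOn_waveFn hm g hg).comp (by fun_prop)
        (fun ζ hζ => by simpa using hζ)
  · intro ζ h0 hπ
    have e1 := hCf' _ (h1 ζ ⟨h0, hπ⟩)
    have e2 := hCg' _ (h2 ζ ⟨h0, hπ⟩)
    have e3 := exp_neg_abs_sq_le ζ.re
    simp only [Complex.conj_re, Complex.sub_re, Complex.mul_re, Complex.ofReal_re, Complex.I_re,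
      mul_zero, Complex.ofReal_im, Complex.I_im, mul_one, sub_zero] at e1 e2
    rw [norm_mul, norm_mul, RCLike.norm_conj]
    calc _ ≤ (Cf * Real.exp (-|ζ.re|)) * (Cg * Real.exp (-|ζ.re|)) * B := by
          gcongr
          exact hb ζ h0 hπ
      _ = Cf * Cg * B * Real.exp (-|ζ.re|) ^ 2 := by ring
      _ ≤ _ := by gcongr

end Contour

/-! ### One self-conjugate particle -/

section Scalar

variable {ϑ : ℝ → ℝ} {S : ℂ → ℂ}

lemma IsTwoParticleS.continuous_real (h : IsTwoParticleS ϑ S) : Continuous fun θ : ℝ => S θ :=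
  h.continuousOn.comp_continuous Complex.continuous_ofReal fun θ => by simp [Real.pi_pos.le]

/-- The step functions disappear: for a < b the left side is the inverse of S(b - a), which is S(a -
b) by unitarity. The diagonal is excluded since S(0) may be -1. -/
lemma IsTwoParticleS.exp_phase (h : IsTwoParticleS ϑ S) {a b : ℝ} (hab : a ≠ b) :
    Complex.exp (Complex.I * ((phaseBelow ϑ a b - phaseBelow ϑ b a : ℝ) : ℂ)) =
      S ((a - b : ℝ) : ℂ) := by
  unfold phaseBelow
  rcases lt_or_gt_of_ne hab with hlt | hgt
  · rw [if_neg hlt.not_gt, if_pos hlt]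
    have h1 := h.unitary (b - a)
    rw [h.phase, ← Complex.ofReal_neg, neg_sub] at h1
    rw [zero_sub, Complex.ofReal_neg, mul_neg, Complex.exp_neg]
    exact inv_eq_of_mul_eq_one_right h1
  · rw [if_pos hgt, if_neg hgt.not_gt, sub_zero, h.phase]

lemma IsTwoParticleS.compatiblePhases (h : IsTwoParticleS ϑ S) :
    CompatiblePhases volume id (phaseBelow ϑ) (phaseBelow ϑ) := by
  have hd : ∀ ξ, phaseBelow ϑ ξ ξ = 0 := fun ξ => by simp [phaseBelow]
  have hm : MeasurablePhase (phaseBelow ϑ) := by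
    -- ϑ itself need not be measurable; only its exponential is controlled, through the continuity
    -- of S.
    have : (fun z : ℝ × ℝ => Complex.exp (Complex.I * (phaseBelow ϑ z.1 z.2 : ℂ))) =
        fun z => if z.2 < z.1 then S ((z.1 - z.2 : ℝ) : ℂ) else 1 := by
      funext z
      by_cases hz : z.2 < z.1
      · simp only [phaseBelow, if_pos hz, h.phase]
      · simp [phaseBelow, hz]
    rw [MeasurablePhase, this]
    exact Measurable.ite (measurableSet_lt measurable_snd measurable_fst)
      (h.continuous_real.measurable.comp (measurable_fst.sub measurable_snd)) measurable_const
  exact {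
    involutive := fun _ => rfl
    measurePreserving := MeasurePreserving.id _
    diag := hd
    diag_scattering := hd
    pair := fun _ _ => rfl
    conj_phase := fun _ _ => rfl
    conj_scattering := fun _ _ => rfl
    measurable_phase := hm
    measurable_scattering := hm }

lemma ae_forall_ne {n : ℕ} (η : Fin n → ℝ) : ∀ᵐ θ : ℝ, ∀ j, θ ≠ η j :=
  ae_all_iff.2 fun j => by simp [ae_iff]

lemma IsTwoParticleS.contraction (h : IsTwoParticleS ϑ S) {m : ℝ} (hm : 0 < m)
    {f g : 𝓢(ℝ × ℝ, ℂ)} (hf : Function.support f ⊆ wedge) (hg : Function.support g ⊆ wedge)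
    {n : ℕ} (η : Fin n → ℝ) :
    ∫ θ : ℝ, conj (waveFn m f θ) * waveFn m g (θ - Real.pi * Complex.I) * Complex.exp (Complex.I *
        ((∑ j, phaseBelow ϑ θ (η j) - ∑ j, phaseBelow ϑ (η j) θ : ℝ) : ℂ)) =
      ∫ θ : ℝ, waveFn m g θ * conj (waveFn m f (θ - Real.pi * Complex.I)) * Complex.exp (Complex.I *
        ((∑ j, phaseBelow ϑ (η j) θ - ∑ j, phaseBelow ϑ θ (η j) : ℝ) : ℂ)) := by
  obtain ⟨B, hB⟩ := h.bounded
  have key := integral_waveFn_crossing hm hf hg (H := fun ζ => ∏ j, S (ζ - η j)) (B := ∏ _j : Fin n, B)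
    (continuousOn_finsetProd _ fun j _ => h.continuousOn.comp (by fun_prop)
      fun ζ hζ => by simpa using hζ)
    (DifferentiableOn.fun_finsetProd fun j _ => h.differentiableOn.comp (by fun_prop)
      fun ζ hζ => by simpa using hζ)
    (fun ζ h0 h1 => by
      rw [norm_prod]
      exact Finset.prod_le_prod (fun _ _ => norm_nonneg _)
        fun j _ => hB _ (by simpa using h0) (by simpa using h1))
  have hprod : ∀ v w : Fin n → ℝ, Complex.exp (Complex.I * ((∑ j, v j - ∑ j, w j : ℝ) : ℂ)) =
      ∏ j, Complex.exp (Complex.I * ((v j - w j : ℝ) : ℂ)) := fun v w => by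
    rw [← Complex.exp_sum, ← Finset.mul_sum, ← Finset.sum_sub_distrib, Complex.ofReal_sum]
  convert key using 1
  · refine integral_congr_ae ?_
    filter_upwards [ae_forall_ne η] with θ hθ
    simp only [hprod, h.exp_phase (hθ _)]
    simp only [Complex.ofReal_sub]
  · refine integral_congr_ae ?_
    filter_upwards [ae_forall_ne η] with θ hθ
    simp only [hprod, h.exp_phase (hθ _).symm]
    congr 2
    -- On the shifted edge, crossing turns S(θ - ηⱼ + iπ) into S(ηⱼ - θ), the phase of the opposite
    -- contraction.
    funext j
    have := h.crossing (θ - η j)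
    push_cast at this ⊢
    rw [neg_sub] at this
    rw [← this]
    congr 1
    ring

lemma scalarZ_vacuum (m : ℝ) (ϑ : ℝ → ℝ) (f : ℝ × ℝ → ℂ) :
    scalarZ m ϑ f vacuum =
      creation .bose (fun θ : ℝ => waveFn m f (θ - Real.pi * Complex.I)) vacuum := by
  have h0 : zAnn volume (phaseBelow ϑ) (fun θ => waveFn m f θ) vacuum = 0 := by
    funext n η
    simp [zAnn, zPoint, annihilate, expDensity, vacuum]
  rw [scalarZ, h0, zero_add, creation]
  funext n η
  match n with
  | 0 => rfl
  | 1 => simp [zCre, phaseBelow]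
  | n + 2 => simp [zCre, vacuum]

lemma waveFn_sub_pi_of_real (m : ℝ) {f : ℝ × ℝ → ℂ} (hf : ∀ x, (f x).im = 0) (θ : ℝ) :
    waveFn m f (θ - Real.pi * Complex.I) = conj (waveFn m f θ) := by
  have h := waveFn_conj m f θ
  have hc : (fun x => conj (f x)) = f := funext fun x => Complex.conj_eq_iff_im.2 (hf x)
  rwa [hc, Complex.conj_ofReal] at h

end Scalar

/-! ### The Federbush model -/

section Federbush

instance : SigmaFinite fedMeasure := by
  unfold fedMeasure; infer_instance

lemma fedMeasure_restrict (p : Fin 2 × Bool) :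
    fedMeasure.restrict (Prod.snd ⁻¹' {p}) = Measure.map (fun θ : ℝ => (θ, p)) volume := by
  have h : (Prod.snd ⁻¹' {p} : Set FedLabel) = Set.univ ×ˢ {p} := by ext; simp
  rw [h, fedMeasure, ← Measure.prod_restrict, Measure.restrict_univ, Measure.restrict_singleton,
    Measure.count_singleton, one_smul, Measure.prod_dirac]

lemma measurableEmbedding_label (p : Fin 2 × Bool) :
    MeasurableEmbedding fun θ : ℝ => ((θ, p) : FedLabel) :=
  measurableEmbedding_prod_mk_right p

lemma measurableSet_label (p : Fin 2 × Bool) :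
    MeasurableSet (Prod.snd ⁻¹' {p} : Set FedLabel) :=
  measurable_snd (measurableSet_singleton p)

lemma integral_fedMeasure {F : FedLabel → ℂ} (p : Fin 2 × Bool) (hF : ∀ ξ, ξ.2 ≠ p → F ξ = 0) :
    ∫ ξ, F ξ ∂fedMeasure = ∫ θ : ℝ, F (θ, p) := by
  rw [← (measurableEmbedding_label p).integral_map, ← fedMeasure_restrict]
  refine (setIntegral_eq_integral_of_forall_compl_eq_zero fun ξ hξ => hF ξ ?_).symm
  simpa using hξ

lemma memLp_component (s : Fin 2) (q : Bool) {h : ℝ → ℂ} (hh : MemLp h 2) :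
    MemLp (component s q h) 2 fedMeasure := by
  have h1 : component s q h = (Prod.snd ⁻¹' {(s, q)} : Set FedLabel).indicator fun ξ => h ξ.1 := by
    funext ξ
    simp [component, Set.indicator]
  rw [h1, memLp_indicator_iff_restrict (measurableSet_label _), fedMeasure_restrict,
    (measurableEmbedding_label _).memLp_map_measure_iff]
  exact hh

lemma charge_not (q : Bool) : charge (!q) = -charge q := by
  cases q <;> simp [charge]

lemma measurePreserving_fedConj : MeasurePreserving fedConj fedMeasure fedMeasure := by
  have h : MeasurePreserving (fun p : Fin 2 × Bool => (p.1, !p.2)) Measure.count Measure.count := by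
    refine ⟨.of_discrete, Measure.ext fun s hs => ?_⟩
    have hinv : Function.Involutive fun p : Fin 2 × Bool => (p.1, !p.2) := fun p => by simp
    rw [Measure.map_apply .of_discrete hs, ← Measure.count_injective_image hinv.injective,
      Set.image_preimage_eq _ hinv.surjective]
  exact (MeasurePreserving.id volume).prod h

lemma measurable_charge : Measurable charge := .of_discrete

lemma compatiblePhases_fed (g : ℝ) :
    CompatiblePhases fedMeasure fedConj (fedKernel g) (fedScattering g) where
  involutive ξ := by simp [fedConj]
  measurePreserving := measurePreserving_fedConj
  diag ξ := by simp [fedKernel]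
  diag_scattering ξ := by
    simp only [fedScattering]
    rw [if_neg]
    rintro ⟨h1, h2⟩
    rw [h1] at h2
    exact zero_ne_one h2
  -- The scattering kernel counts a I–II pair once with the sign ε; the operator kernel counts it
  -- only for the particle of larger rapidity, and its species sign reproduces ε.
  pair ξ η := by
    obtain ⟨a, s, q⟩ := ξ
    obtain ⟨b, s', q'⟩ := η
    rcases lt_trichotomy a b with h | h | h
    · fin_cases s <;> fin_cases s' <;>
        simp [fedScattering, fedKernel, h, h.not_gt, Real.sign_of_neg, Real.sign_of_pos]
      all_goals ring
    · subst h
      simp [fedScattering, fedKernel]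
    · fin_cases s <;> fin_cases s' <;>
        simp [fedScattering, fedKernel, h, h.not_gt, Real.sign_of_neg, Real.sign_of_pos]
      all_goals ring
  conj_phase ξ η := by
    simp only [fedKernel, fedConj, charge_not, mul_neg, neg_mul, neg_neg]
    rfl
  conj_scattering ξ η := by simp [fedScattering, fedConj, charge_not]
  measurable_phase := by
    have h1 : Measurable fun z : FedLabel × FedLabel => z.1.2.1 := by fun_prop
    have h2 : Measurable fun z : FedLabel × FedLabel => z.2.2.1 := by fun_prop
    have hc1 : Measurable fun z : FedLabel × FedLabel => charge z.1.2.2 :=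
      measurable_charge.comp (by fun_prop)
    have hc2 : Measurable fun z : FedLabel × FedLabel => charge z.2.2.2 :=
      measurable_charge.comp (by fun_prop)
    have : Measurable fun z : FedLabel × FedLabel => fedKernel g z.1 z.2 := by
      have h3 : MeasurableSet {z : FedLabel × FedLabel | z.2.1 < z.1.1} :=
        measurableSet_lt (by fun_prop) (by fun_prop)
      refine Measurable.ite ((measurableSet_eq_fun h1 h2).compl.inter h3) ?_ measurable_const
      exact (Measurable.ite (h1 (measurableSet_singleton 0)) measurable_const
        measurable_const).mul ((measurable_const.mul hc1).mul hc2)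
    exact Complex.measurable_exp.comp ((Complex.measurable_ofReal.comp this).const_mul _)
  measurable_scattering := by
    have h1 : Measurable fun z : FedLabel × FedLabel => z.1.2.1 := by fun_prop
    have h2 : Measurable fun z : FedLabel × FedLabel => z.2.2.1 := by fun_prop
    have hc1 : Measurable fun z : FedLabel × FedLabel => charge z.1.2.2 :=
      measurable_charge.comp (by fun_prop)
    have hc2 : Measurable fun z : FedLabel × FedLabel => charge z.2.2.2 :=
      measurable_charge.comp (by fun_prop)
    have hs : Measurable Real.sign :=
      Measurable.ite measurableSet_Iio measurable_const
        (Measurable.ite measurableSet_Ioi measurable_const measurable_const)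
    have : Measurable fun z : FedLabel × FedLabel => fedScattering g z.1 z.2 := by
      refine Measurable.ite ((h1 (measurableSet_singleton 0)).inter
        (h2 (measurableSet_singleton 1))) ?_ measurable_const
      exact ((measurable_const.mul hc1).mul hc2).mul (hs.comp (by fun_prop))
    exact Complex.measurable_exp.comp ((Complex.measurable_ofReal.comp this).const_mul _)

/-- The phase acquired by a particle of species `s` and charge `q` when it is moved past `η`. -/
def fedPhase (g : ℝ) (s : Fin 2) (q : Bool) (η : FedLabel) : ℝ :=
  if s ≠ η.2.1 then (if s = 0 then 1 else -1) * (Real.pi * g * charge q * charge η.2.2) else 0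

/-- The species sign of the kernel is antisymmetric, so both orders of the rapidities give the same
difference; the phase does not depend on θ. -/
lemma fedKernel_sub {g θ : ℝ} {s : Fin 2} {q : Bool} {η : FedLabel} (h : θ ≠ η.1) :
    fedKernel g (θ, s, q) η - fedKernel g η (θ, s, q) = fedPhase g s q η := by
  obtain ⟨b, s', q'⟩ := η
  replace h : θ ≠ b := h
  rcases lt_or_gt_of_ne h with h | h <;>
    fin_cases s <;> fin_cases s' <;> simp [fedKernel, fedPhase, h, h.not_gt]
  all_goals ring

lemma fedPhase_not (g : ℝ) (s : Fin 2) (q : Bool) (η : FedLabel) :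
    fedPhase g s (!q) η = -fedPhase g s q η := by
  simp only [fedPhase, charge_not]
  split_ifs <;> ring

/-- The two sides contract opposite charges in opposite orders. Each change flips the sign of the
phase, so both carry the same constant, which passes through the contour shift. -/
lemma fed_contraction {m : ℝ} (hm : 0 < m) (g : ℝ) {f h : 𝓢(ℝ × ℝ, ℂ)}
    (hf : Function.support f ⊆ wedge) (hh : Function.support h ⊆ wedge) (s : Fin 2) (q : Bool)
    {n : ℕ} (η : Fin n → FedLabel) :
    ∫ θ : ℝ, conj (waveFn m f θ) * waveFn m h (θ - Real.pi * Complex.I) * Complex.exp (Complex.I *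
        ((∑ j, fedKernel g (θ, s, !q) (η j) - ∑ j, fedKernel g (η j) (θ, s, !q) : ℝ) : ℂ)) =
      ∫ θ : ℝ, waveFn m h θ * conj (waveFn m f (θ - Real.pi * Complex.I)) * Complex.exp (Complex.I *
        ((∑ j, fedKernel g (η j) (θ, s, q) - ∑ j, fedKernel g (θ, s, q) (η j) : ℝ) : ℂ)) := by
  have key := integral_waveFn_crossing hm hf hh
    (H := fun _ => Complex.exp (Complex.I * ((-∑ j, fedPhase g s q (η j) : ℝ) : ℂ)))
    continuousOn_const (differentiableOn_const _) (fun _ _ _ => le_rfl)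
  convert key using 1
  · refine integral_congr_ae ?_
    filter_upwards [ae_forall_ne fun j => (η j).1] with θ hθ
    rw [← Finset.sum_sub_distrib, Finset.sum_congr rfl fun j _ => fedKernel_sub (hθ j)]
    simp only [fedPhase_not, Finset.sum_neg_distrib]
  · refine integral_congr_ae ?_
    filter_upwards [ae_forall_ne fun j => (η j).1] with θ hθ
    rw [← neg_sub (∑ j, fedKernel g (θ, s, q) (η j)), ← Finset.sum_sub_distrib,
      Finset.sum_congr rfl fun j _ => fedKernel_sub (hθ j)]

lemma fedZ_commuteOnFinite {m : Fin 2 → ℝ} (hm : ∀ s, 0 < m s) (g : ℝ) (s s' : Fin 2) (q q' : Bool)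
    {f h : 𝓢(ℝ × ℝ, ℂ)} (hf : Function.support f ⊆ wedge) (hh : Function.support h ⊆ wedge) :
    CommuteOnFinite .fermi fedMeasure (conjByJ (fedJ g) (fedZ m g s q f)) (fedZ m g s' q' h) := by
  refine (compatiblePhases_fed g).commuteOnFinite
    (memLp_component s q (memLp_waveFn (hm s) f))
    (memLp_component s (!q) (memLp_waveFn_sub_pi (hm s) f))
    (memLp_component s' q' (memLp_waveFn (hm s') h))
    (memLp_component s' (!q') (memLp_waveFn_sub_pi (hm s') h)) fun n η => ?_
  -- A contraction needs the charge conjugate of one label to meet the other; unless species and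
  -- field type agree, the supports are disjoint and both integrals are zero.
  by_cases hsq : s = s' ∧ q = q'
  · obtain ⟨rfl, rfl⟩ := hsq
    rw [integral_fedMeasure (s, !q) fun ξ hξ => by simp [component, hξ],
      integral_fedMeasure (s, q) fun ξ hξ => by simp [component, hξ]]
    simpa [component, fedConj] using fed_contraction (hm s) g hf hh s q η
  · have h1 : ∀ (ξ : FedLabel) (a b : ℝ → ℂ),
        conj (component s q a (fedConj ξ)) * component s' (!q') b ξ = 0 := by
      rintro ⟨θ, t, r⟩ a b
      by_cases h1 : t = s ∧ (!r) = q
      · obtain ⟨rfl, rfl⟩ := h1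
        have : ¬(t = s' ∧ r = !q') := fun h => hsq ⟨h.1, by simp [h.2]⟩
        simp [component, fedConj, this]
      · have : component s q a (fedConj (θ, t, r)) = 0 :=
          if_neg fun h => h1 ⟨congrArg Prod.fst h, congrArg Prod.snd h⟩
        simp [this]
    have h2 : ∀ (ξ : FedLabel) (a b : ℝ → ℂ),
        component s' q' a ξ * conj (component s (!q) b (fedConj ξ)) = 0 := by
      rintro ⟨θ, t, r⟩ a b
      by_cases h1 : t = s' ∧ r = q'
      · obtain ⟨rfl, rfl⟩ := h1
        have : ¬(t = s ∧ r = q) := fun h => hsq ⟨h.1.symm, h.2.symm⟩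
        simp [component, fedConj, this]
      · simp [component, fedConj, h1]
    simp only [h1, h2, zero_mul]

lemma zSharp_eq {X : Type} [MeasurableSpace X] (σ : Statistics) (μ : Measure X) (u : X → X → ℝ)
    (b : Bool) (φ : X → ℂ) : zSharp σ μ u b φ = fun ψ =>
      zAnn μ u (if b then 0 else φ) ψ + zCre σ u (if b then φ else 0) ψ := by
  funext ψ n η
  cases b with
  | false => cases n <;> simp [zSharp, zCre]
  | true => simp [zSharp, zAnn]

/-- Charge conjugation preserves the species, so both contraction integrands vanish pointwise, and
neither analyticity nor localization is needed. -/
lemma zSharp_commuteOnFinite (g : ℝ) {s s' : Fin 2} (hs : s ≠ s') (b b' : Bool)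
    {φ χ : FedLabel → ℂ} (hφ : MemLp φ 2 fedMeasure) (hχ : MemLp χ 2 fedMeasure)
    (hφs : ∀ ξ, ξ.2.1 ≠ s → φ ξ = 0) (hχs : ∀ ξ, ξ.2.1 ≠ s' → χ ξ = 0) :
    CommuteOnFinite .fermi fedMeasure
      (conjByJ (fedJ g) (zSharp .fermi fedMeasure (fedKernel g) b φ))
      (zSharp .fermi fedMeasure (fedKernel g) b' χ) := by
  have h0 : ∀ ξ, φ (fedConj ξ) = 0 ∨ χ ξ = 0 := fun ξ => by
    by_cases h : ξ.2.1 = s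
    · exact .inr (hχs ξ (h ▸ hs))
    · exact .inl (hφs _ h)
  have hz : ∀ (b : Bool) {φ : FedLabel → ℂ}, MemLp φ 2 fedMeasure →
      MemLp (if b then φ else 0) 2 fedMeasure := fun b φ hφ => by
    cases b
    · exact MemLp.zero
    · exact hφ
  have hz' : ∀ (b : Bool) {φ : FedLabel → ℂ}, MemLp φ 2 fedMeasure →
      MemLp (if b then 0 else φ) 2 fedMeasure := fun b φ hφ => by
    cases b
    · exact hφ
    · exact MemLp.zero
  rw [zSharp_eq, zSharp_eq]
  refine (compatiblePhases_fed g).commuteOnFinite (hz' b hφ) (hz b hφ) (hz' b' hχ) (hz b' hχ)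
    fun n η => ?_
  have h1 : ∀ ξ, conj ((if b then 0 else φ) (fedConj ξ)) * (if b' then χ else 0) ξ = 0 := fun ξ => by
    rcases h0 ξ with h | h <;> cases b <;> cases b' <;> simp [h]
  have h2 : ∀ ξ, (if b' then 0 else χ) ξ * conj ((if b then φ else 0) (fedConj ξ)) = 0 := fun ξ => by
    rcases h0 ξ with h | h <;> cases b <;> cases b' <;> simp [h]
  simp only [h1, h2, zero_mul]

lemma fedZ_isHermitianConj {m : Fin 2 → ℝ} (hm : ∀ s, 0 < m s) (g : ℝ) (s : Fin 2) (q : Bool)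
    (f : 𝓢(ℝ × ℝ, ℂ)) : IsHermitianConj .fermi fedMeasure (fedZ m g s q f)
      (fedZ m g s (!q) fun x => conj (f x)) := by
  have h := isHermitianConj_zAnn_add_zCre (σ := .fermi) (compatiblePhases_fed g).diag
    (compatiblePhases_fed g).measurable_phase
    (memLp_component s q (memLp_waveFn (hm s) f))
    (memLp_component s (!q) (memLp_waveFn_sub_pi (hm s) f))
  have hc : ∀ (q : Bool) (a : ℝ → ℂ), (fun ξ => conj (component s q a ξ)) =
      component s q fun θ => conj (a θ) := fun q a => by
    funext ξ
    simp only [component]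
    split_ifs <;> simp
  have e : (fedZ m g s (!q) fun x => conj (f x)) = fun ψ =>
      zAnn fedMeasure (fedKernel g) (fun ξ => conj (component s (!q)
        (fun θ => waveFn (m s) f (θ - Real.pi * Complex.I)) ξ)) ψ +
      zCre .fermi (fedKernel g) (fun ξ => conj (component s q (fun θ => waveFn (m s) f θ) ξ)) ψ := by
    funext ψ
    rw [fedZ, hc, hc, Bool.not_not]
    simp only [waveFn_conj]
    simp only [waveFn_conj_apply, Complex.conj_ofReal]
  rw [e]
  exact h

end Federbush

end FWG

end

/-! ### The scalar and the Federbush model assembled -/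

theorem mainTheorem2 :
    (∀ (m : ℝ) (ϑ : ℝ → ℝ) (S : ℂ → ℂ), 0 < m → IsTwoParticleS ϑ S →
      PreservesDomain .bose volume (scalarJ ϑ) ∧
      (∀ f : 𝓢(ℝ × ℝ, ℂ),
        PreservesDomain .bose volume (scalarZ m ϑ f) ∧
        IsHermitianConj .bose volume (scalarZ m ϑ f) (scalarZ m ϑ fun x => conj (f x))) ∧
      (∀ f g : 𝓢(ℝ × ℝ, ℂ), Function.support f ⊆ wedge → Function.support g ⊆ wedge →
        CommuteOnFinite .bose volume (conjByJ (scalarJ ϑ) (scalarZ m ϑ f)) (scalarZ m ϑ g)) ∧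
      (∀ f : 𝓢(ℝ × ℝ, ℂ), Function.support f ⊆ wedge →
        VecEq volume (scalarZ m ϑ f vacuum)
          (creation .bose (fun θ => waveFn m f (θ - Real.pi * Complex.I)) vacuum) ∧
        ((∀ x, (f x).im = 0) →
          VecEq volume (scalarZ m ϑ f vacuum)
            (creation .bose (fun θ => conj (waveFn m f θ)) vacuum)))) ∧
    (∀ (m : Fin 2 → ℝ) (g : ℝ), (∀ s, 0 < m s) →
      PreservesDomain .fermi fedMeasure (fedJ g) ∧
      (∀ (s : Fin 2) (q : Bool) (f : 𝓢(ℝ × ℝ, ℂ)),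
        PreservesDomain .fermi fedMeasure (fedZ m g s q f) ∧
        IsHermitianConj .fermi fedMeasure (fedZ m g s q f)
          (fedZ m g s (!q) fun x => conj (f x))) ∧
      (∀ (s s' : Fin 2) (b b' : Bool) (φ χ : FedLabel → ℂ), s ≠ s' →
        MemLp φ 2 fedMeasure → MemLp χ 2 fedMeasure →
        (∀ ξ, ξ.2.1 ≠ s → φ ξ = 0) → (∀ ξ, ξ.2.1 ≠ s' → χ ξ = 0) →
        CommuteOnFinite .fermi fedMeasure
          (conjByJ (fedJ g) (zSharp .fermi fedMeasure (fedKernel g) b φ))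
          (zSharp .fermi fedMeasure (fedKernel g) b' χ)) ∧
      (∀ (s s' : Fin 2) (q q' : Bool) (f h : 𝓢(ℝ × ℝ, ℂ)),
        Function.support f ⊆ wedge → Function.support h ⊆ wedge →
        CommuteOnFinite .fermi fedMeasure
          (conjByJ (fedJ g) (fedZ m g s q f)) (fedZ m g s' q' h))) := by
  refine ⟨fun m ϑ S hm hS => ?_, fun m g hm => ?_⟩
  · have hP := hS.compatiblePhases
    refine ⟨preservesDomain_modularJ hP.measurePreserving hP.measurable_scattering,
      fun f => ⟨preservesDomain_zAnn_add_zCre hP.diag hP.measurable_phase (memLp_waveFn hm f)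
        (memLp_waveFn_sub_pi hm f), ?_⟩, fun f g hf hg => ?_, fun f _ => ?_⟩
    · have h := isHermitianConj_zAnn_add_zCre (σ := .bose) hP.diag hP.measurable_phase
        (memLp_waveFn hm f) (memLp_waveFn_sub_pi hm f)
      have e : (scalarZ m ϑ fun x => conj (f x)) = fun ψ =>
          zAnn volume (phaseBelow ϑ)
            (fun θ : ℝ => conj (waveFn m f (θ - Real.pi * Complex.I))) ψ +
          zCre .bose (phaseBelow ϑ) (fun θ : ℝ => conj (waveFn m f θ)) ψ := by
        funext ψ
        simp only [scalarZ, waveFn_conj]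
        simp only [waveFn_conj_apply, Complex.conj_ofReal]
      rw [e]
      exact h
    · exact hP.commuteOnFinite (memLp_waveFn hm f) (memLp_waveFn_sub_pi hm f) (memLp_waveFn hm g)
        (memLp_waveFn_sub_pi hm g) fun n η => hS.contraction hm hf hg η
    · refine ⟨fun n => by rw [scalarZ_vacuum], fun hreal n => ?_⟩
      simp only [scalarZ_vacuum, waveFn_sub_pi_of_real m hreal]
      rfl
  · have hP := compatiblePhases_fed g
    exact ⟨preservesDomain_modularJ hP.measurePreserving hP.measurable_scattering,
      fun s q f => ⟨preservesDomain_zAnn_add_zCre hP.diag hP.measurable_phase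
        (memLp_component s q (memLp_waveFn (hm s) f))
        (memLp_component s (!q) (memLp_waveFn_sub_pi (hm s) f)), fedZ_isHermitianConj hm g s q f⟩,
      fun s s' b b' φ χ hs hφ hχ hφs hχs => zSharp_commuteOnFinite g hs b b' hφ hχ hφs hχs,
      fun s s' q q' f h hf hh => fedZ_commuteOnFinite hm g s s' q q' hf hh⟩
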